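/- Words are elements of the free semigroup over the countably infinite alphabet $\{x_1,x_2,\dots\}$. A semigroup variety is a class of semigroups defined by a set of identities between words; $\operatorname{var}\Sigma$ is the variety defined by a set $\Sigma$ of identities. Semigroup varieties form a lattice under inclusion: the meet is the intersection, and the join is the variety generated by the union. Let $\mathcal{SEM}$ be the variety of all semigroups and let $\mathbf{OC}$ be the sublattice of all overcommutative varieties, that is, of all semigroup varieties that contain every commutative semigroup. An element $x$ of a lattice $L$ is *distributive* if $x\vee(y\wedge z)=(x\vee y)\wedge(x\vee z)$ for all $y,z\in L$; *standard* if $(x\vee y)\wedge z=(x\wedge z)\vee(y\wedge z)$ for all $y,z\in L$; *neutral* if, for all $y,z\in L$, the sublattice of $L$ generated by $x,y,z$ is distributive. *Codistributive* and *costandard* elements are defined dually to distributive and standard ones. Let $\Lambda$ be the set of all partitions $\lambda=(\ell_1,\dots,\ell_m)$, $\ell_1\ge\cdots\ge\ell_m\ge1$, with $m\ge2$ parts, and put $n=\ell_1+\cdots+\ell_m$. Let $W_\lambda$ be the set of all words of length $n$ in which exactly the letters $x_1,\dots,x_m$ occur and $x_i$ occurs exactly $\ell_i$ times for $i=1,\dots,m$,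 and let $\mathcal W_\lambda=\operatorname{var}\{u\approx v\mid u,v\in W_\lambda\}$. For $k\ge0$ let $\lambda^k=(\ell_1,\dots,\ell_m,1,\dots,1)$ with $k$ additional components equal to $1$. Let $q(\lambda)$ be the number of components of $\lambda$ equal to $1$, let $r(\lambda)$ be the sum of the components greater than $1$, and let $s(\lambda)=\max\{r(\lambda)-q(\lambda)-\delta,0\}$, where $\delta=0$ if $\lambda=(2,1)$ and $\delta=1$ otherwise. Put $$\mathcal S_\lambda=\bigwedge_{i=0}^{s(\lambda)}\mathcal W_{\lambda^i}.$$ **Theorem.** For an overcommutative semigroup variety $\mathcal V$, the following are equivalent: 1. $\mathcal V$ is a distributive element of the lattice $\mathbf{OC}$; 2. $\mathcal V$ is a codistributive element of the lattice $\mathbf{OC}$; 3. $\mathcal V$ is a standard element of the lattice $\mathbf{OC}$; 4. $\mathcal V$ is a costandard element of the lattice $\mathbf{OC}$; 5. $\mathcal V$ is a neutral element of the lattice $\mathbf{OC}$; 6. either $\mathcal V=\mathcal{SEM}$, or $\mathcal V=\bigwedge_{i=1}^k\mathcal S_{\lambda_i}$ for some $k\ge1$ and some partitions $\lambda_1,\dots,\lambda_k\in\Lambda$.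 -/

import Mathlib

universe u

/-! ### Special elements of a lattice -/

section SpecialElements

variable {L : Type*} [Lattice L]

/-- `x ∨ (y ∧ z) = (x ∨ y) ∧ (x ∨ z)` for all `y`, `z`. -/
def IsDistributiveElement (x : L) : Prop :=
  ∀ y z : L, x ⊔ (y ⊓ z) = (x ⊔ y) ⊓ (x ⊔ z)

/-- `x ∧ (y ∨ z) = (x ∧ y) ∨ (x ∧ z)` for all `y`, `z`. -/
def IsCodistributiveElement (x : L) : Prop :=
  ∀ y z : L, x ⊓ (y ⊔ z) = (x ⊓ y) ⊔ (x ⊓ z)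

/-- `(x ∨ y) ∧ z = (x ∧ z) ∨ (y ∧ z)` for all `y`, `z`. -/
def IsStandardElement (x : L) : Prop :=
  ∀ y z : L, (x ⊔ y) ⊓ z = (x ⊓ z) ⊔ (y ⊓ z)

/-- `(x ∧ y) ∨ z = (x ∨ z) ∧ (y ∨ z)` for all `y`, `z`. -/
def IsCostandardElement (x : L) : Prop :=
  ∀ y z : L, (x ⊓ y) ⊔ z = (x ⊔ z) ⊓ (y ⊔ z)

/-- For all `y`, `z`, the sublattice generated by `x`, `y`, `z` is distributive. -/
def IsNeutralElement (x : L) : Prop :=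
  ∀ y z : L, ∀ a ∈ latticeClosure ({x, y, z} : Set L),
    ∀ b ∈ latticeClosure ({x, y, z} : Set L), ∀ c ∈ latticeClosure ({x, y, z} : Set L),
      a ⊓ (b ⊔ c) = (a ⊓ b) ⊔ (a ⊓ c)

end SpecialElements

/-! ### Words -/

/-- Words over the alphabet `x₁, x₂, …`; the letter `x_{i+1}` is `FreeSemigroup.of i`. -/
abbrev Word : Type := FreeSemigroup ℕ

namespace Word

/-- The list of letters of a word, from left to right. -/
def letters (w : Word) : List ℕ := w.head :: w.tail

/-- The number of occurrences of the letter with index `i`. -/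
def occ (w : Word) (i : ℕ) : ℕ := w.letters.count i

/-- The set of (indices of) letters that occur in a word. -/
def content (w : Word) : Finset ℕ := w.letters.toFinset

/-- The numbers of occurrences of the letters that occur in `w`, in non-increasing order. -/
def part (w : Word) : List ℕ := (w.content.val.map w.occ).sort (fun a b => a ≥ b)

end Word

/-! ### Semigroup varieties -/

/-- An identity `p.1 ≈ p.2` holds in `S` if both sides are equal under every substitution of
elements of `S` for the letters. -/
def SatisfiesIdentity (S : Type u) [Semigroup S] (p : Word × Word) : Prop :=
  ∀ φ : Word →ₙ* S, φ p.1 = φ p.2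

/-- The class of all semigroups that satisfy all identities of `E`. -/
def modelClass (E : Set (Word × Word)) : Set Semigrp.{u} :=
  {S | ∀ p ∈ E, SatisfiesIdentity S p}

/-- The identities that hold in all members of a class of semigroups. -/
def identitiesOf (C : Set Semigrp.{u}) : Set (Word × Word) :=
  {p | ∀ S ∈ C, SatisfiesIdentity S p}

/-- A semigroup variety: a class of semigroups defined by a set of identities. -/
@[ext]
structure SemigroupVariety : Type (u + 1) where
  carrier : Set Semigrp.{u}
  equational : ∃ E : Set (Word × Word), carrier = modelClass E

namespace SemigroupVariety

/-- The variety given by a set of identities. -/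
def var (E : Set (Word × Word)) : SemigroupVariety.{u} := ⟨modelClass E, E, rfl⟩

/-- The variety generated by a class of semigroups. -/
def generated (C : Set Semigrp.{u}) : SemigroupVariety.{u} := var (identitiesOf C)

theorem subset_generated (C : Set Semigrp.{u}) : C ⊆ (generated C).carrier :=
  fun S hS _ hp => hp S hS

/-- `generated C` is the least variety that contains `C`. -/
theorem generated_subset {C : Set Semigrp.{u}} {V : SemigroupVariety.{u}} (h : C ⊆ V.carrier) :
    (generated C).carrier ⊆ V.carrier := by
  obtain ⟨E, hE⟩ := V.equational
  rw [hE] at h ⊢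
  exact fun S hS p hp => hS p fun T hT => h hT p hp

/-- Varieties are ordered by inclusion; the meet is the intersection and the join is the variety
generated by the union. -/
instance : Lattice SemigroupVariety.{u} where
  le V W := V.carrier ⊆ W.carrier
  le_refl _ := subset_rfl
  le_trans _ _ _ := Set.Subset.trans
  le_antisymm _ _ h₁ h₂ := SemigroupVariety.ext (Set.Subset.antisymm h₁ h₂)
  inf V W := ⟨V.carrier ∩ W.carrier, by
    obtain ⟨E, hE⟩ := V.equational
    obtain ⟨E', hE'⟩ := W.equational
    refine ⟨E ∪ E', ?_⟩
    rw [hE, hE']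
    ext S
    constructor
    · rintro ⟨h, h'⟩ p (hp | hp)
      exacts [h p hp, h' p hp]
    · exact fun h => ⟨fun p hp => h p (Or.inl hp), fun p hp => h p (Or.inr hp)⟩⟩
  inf_le_left _ _ := Set.inter_subset_left
  inf_le_right _ _ := Set.inter_subset_right
  le_inf _ _ _ := Set.subset_inter
  sup V W := generated (V.carrier ∪ W.carrier)
  le_sup_left _ _ := Set.subset_union_left.trans (subset_generated _)
  le_sup_right _ _ := Set.subset_union_right.trans (subset_generated _)
  sup_le _ _ _ h₁ h₂ := generated_subset (Set.union_subset h₁ h₂)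

/-- The greatest variety is the variety `SEM` of all semigroups. -/
instance : OrderTop SemigroupVariety.{u} where
  top := ⟨Set.univ, ∅, by ext S; simp [modelClass]⟩
  le_top _ := Set.subset_univ _

/-- The variety of all commutative semigroups. -/
def COM : SemigroupVariety.{u} where
  carrier := {S | ∀ a b : S, a * b = b * a}
  equational := by
    refine ⟨{(FreeSemigroup.of 0 * FreeSemigroup.of 1, FreeSemigroup.of 1 * FreeSemigroup.of 0)},
      ?_⟩
    ext S
    constructor
    · rintro h p rfl φ
      simp only [map_mul]
      exact h _ _
    · intro h a b
      have := h _ rfl (FreeSemigroup.lift fun i => if i = 0 then a else b)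
      simpa using this

end SemigroupVariety

/-- The lattice of overcommutative semigroup varieties: the varieties that contain all commutative
semigroups, with the operations of the lattice of all semigroup varieties. -/
abbrev OC : Type (u + 1) := Set.Ici SemigroupVariety.COM.{u}

/-! ### Partitions and transversals -/

/-- A partition of a positive integer into at least two parts, the components being listed in
non-increasing order. -/
@[ext]
structure Ptn where
  parts : List ℕ
  sorted : parts.Pairwise (· ≥ ·)
  pos : ∀ a ∈ parts, 0 < a
  two_le : 2 ≤ parts.length

namespace Ptn

/-- The number that is partitioned. -/
def n (l : Ptn) : ℕ := l.parts.sum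

/-- The number of parts. -/
def m (l : Ptn) : ℕ := l.parts.length

/-- The number of components equal to `1`. -/
def q (l : Ptn) : ℕ := l.parts.count 1

/-- The sum of the components greater than `1`. -/
def r (l : Ptn) : ℕ := (l.parts.filter (fun a => 1 < a)).sum

/-- `0` for the partition `(2,1)` of `3`, and `1` for all other partitions. -/
def delta (l : Ptn) : ℕ := if l.parts = [2, 1] then 0 else 1

/-- `max {r - q - δ, 0}`, as a truncated subtraction. -/
def s (l : Ptn) : ℕ := l.r - (l.q + l.delta)

/-- The partition `λ^k`, which is `λ` followed by `k` components equal to `1`. -/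
def addOnes (l : Ptn) (k : ℕ) : Ptn where
  parts := l.parts ++ List.replicate k 1
  sorted := by
    refine List.pairwise_append.2 ⟨l.sorted, ?_, ?_⟩
    · exact List.pairwise_replicate.2 (Or.inr le_rfl)
    · intro a ha b hb
      rw [List.eq_of_mem_replicate hb]
      exact l.pos a ha
  pos := by
    intro a ha
    rcases List.mem_append.1 ha with h | h
    · exact l.pos a h
    · rw [List.eq_of_mem_replicate h]
      exact Nat.one_pos
  two_le := by
    rw [List.length_append]
    exact l.two_le.trans (Nat.le_add_right _ _)

/-- The transversal `W_λ`: the words `u` of length `n` with `c(u) = {x₁, …, x_m}` in which the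
numbers of occurrences of `x₁, …, x_m` do not increase and form the partition `λ`. -/
def transversal (l : Ptn) : Set Word :=
  {u | u.length = l.n ∧ Word.content u = Finset.range l.m ∧
    (∀ i, i + 1 < l.m → Word.occ u (i + 1) ≤ Word.occ u i) ∧ Word.part u = l.parts}

/-- The variety `𝒲_λ` given by all identities `u ≈ v` with `u, v ∈ W_λ`. -/
def varW (l : Ptn) : SemigroupVariety.{u} :=
  SemigroupVariety.var {p | p.1 ∈ l.transversal ∧ p.2 ∈ l.transversal}

/-- The variety `𝒮_λ`, the meet of the varieties `𝒲_{λ^i}` for `i = 0, …, s(λ)`. -/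
def varS (l : Ptn) : SemigroupVariety.{u} :=
  (Finset.range (l.s + 1)).inf fun i => (l.addOnes i).varW

end Ptn

/-! ### Fully invariant congruences -/

/-! Passing to equational theories turns the lattice of overcommutative varieties upside down into
the lattice of balanced fully invariant congruences on words. The decisive property of such a
congruence is `IsLocallyTrivialOrFull`: on each class of mutually balanced words it is either
equality or the full relation.

This property gives neutrality. Restriction to a balance class preserves joins and meets of balanced
relations and sends the congruence to a bound of the partition lattice, and a bound together with
any two elements generates a distributive sublattice (`isNeutralElement_of_isLocallyTrivialOrFull`).

Conversely, distributivity and codistributivity both imply `IsSemidistributive`, which is tested on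
congruences concentrated on one balance class (`IsRenamingInvariant.extension`). If letters repeat,
the class has at least three orbits under renaming, and relations generated by single pairs force
fullness. If all letters are distinct, the class is one orbit of a symmetric group. The congruence
is then a subgroup that commutes with every involution outside it, and a nontrivial such subgroup
contains all transpositions.

It remains to describe these congruences. That of `varS` is full exactly on the words above the
partition (`Ptn.eqs_varS`). Finitely many of the varieties `varW` suffice because fullness
propagates to one more linear letter once linear letters are numerous enough (`FullOn.cons_one`).
Finitely many partitions suffice by Higman's lemma (`Ptn.exists_finset_embeds`). -/

/-- A fully invariant congruence on the free semigroup of words. -/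
structure IsFullyInvariant (r : Setoid Word) : Prop where
  mul_left : ∀ (w : Word) {u v : Word}, r u v → r (w * u) (w * v)
  mul_right : ∀ (w : Word) {u v : Word}, r u v → r (u * w) (v * w)
  subst : ∀ (φ : Word →ₙ* Word) {u v : Word}, r u v → r (φ u) (φ v)

theorem Setoid.sup_le_of_forall {α : Type*} {r s : Setoid α} {P : α → α → Prop} (hP : Equivalence P)
    (hr : ∀ {x y}, r x y → P x y) (hs : ∀ {x y}, s x y → P x y) {x y : α} (h : (r ⊔ s) x y) :
    P x y := by
  have : r ⊔ s ≤ ⟨P, hP⟩ := sup_le (fun _ _ h => hr h) (fun _ _ h => hs h)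
  exact this h

theorem Setoid.rel_sup_left {α : Type*} {r s : Setoid α} {x y : α} (h : r x y) : (r ⊔ s) x y :=
  (le_sup_left : r ≤ r ⊔ s) h

theorem Setoid.rel_sup_right {α : Type*} {r s : Setoid α} {x y : α} (h : s x y) : (r ⊔ s) x y :=
  (le_sup_right : s ≤ r ⊔ s) h

namespace IsFullyInvariant

variable {r s : Setoid Word}

theorem mul (hr : IsFullyInvariant r) {a b c d : Word} (h : r a b) (h' : r c d) :
    r (a * c) (b * d) :=
  r.trans' (hr.mul_right c h) (hr.mul_left b h')

theorem inf (hr : IsFullyInvariant r) (hs : IsFullyInvariant s) : IsFullyInvariant (r ⊓ s) where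
  mul_left w _ _ h := ⟨hr.mul_left w h.1, hs.mul_left w h.2⟩
  mul_right w _ _ h := ⟨hr.mul_right w h.1, hs.mul_right w h.2⟩
  subst φ _ _ h := ⟨hr.subst φ h.1, hs.subst φ h.2⟩

/-- The pullback of the join along any operation preserving both relations is an equivalence
containing both, hence contains the join. -/
theorem sup (hr : IsFullyInvariant r) (hs : IsFullyInvariant s) : IsFullyInvariant (r ⊔ s) := by
  have key : ∀ f : Word → Word, (∀ {u v}, r u v → r (f u) (f v)) →
      (∀ {u v}, s u v → s (f u) (f v)) → ∀ {u v}, (r ⊔ s) u v → (r ⊔ s) (f u) (f v) := by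
    intro f h₁ h₂ u v h
    refine Setoid.sup_le_of_forall (P := fun x y => (r ⊔ s) (f x) (f y)) ?_
      (fun h => Setoid.rel_sup_left (h₁ h)) (fun h => Setoid.rel_sup_right (h₂ h)) h
    exact ⟨fun _ => Setoid.refl' _ _, fun h => Setoid.symm' _ h, fun h => Setoid.trans' _ h⟩
  exact ⟨fun w _ _ => key _ (hr.mul_left w) (hs.mul_left w),
    fun w _ _ => key _ (hr.mul_right w) (hs.mul_right w),
    fun φ _ _ => key _ (hr.subst φ) (hs.subst φ)⟩

/-- A fully invariant congruence as a multiplicative congruence. -/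
def toCon (hr : IsFullyInvariant r) : Con Word := { r with mul' := hr.mul }

/-- The relatively free semigroup on countably many generators. -/
def relFree (hr : IsFullyInvariant r) : Semigrp.{u} := Semigrp.of (ULift.{u} hr.toCon.Quotient)

/-- The canonical projection onto the relatively free semigroup. -/
def proj (hr : IsFullyInvariant r) : Word →ₙ* hr.relFree.{u} where
  toFun w := ULift.up (w : hr.toCon.Quotient)
  map_mul' _ _ := rfl

theorem proj_eq_iff (hr : IsFullyInvariant r) {u v : Word} :
    hr.proj.{u} u = hr.proj.{u} v ↔ r u v := by
  constructor
  · intro h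
    exact hr.toCon.eq.1 (ULift.up.inj h)
  · intro h
    exact congrArg ULift.up (hr.toCon.eq.2 h)

theorem proj_surjective (hr : IsFullyInvariant r) : Function.Surjective hr.proj.{u} := by
  rintro ⟨x⟩
  obtain ⟨w, rfl⟩ := Quotient.exists_rep x
  exact ⟨w, rfl⟩

/-- Every homomorphism into the relatively free semigroup lifts through `proj` to a substitution of
words, and `r` is closed under substitutions. -/
theorem relFree_satisfies (hr : IsFullyInvariant r) {p : Word × Word} (hp : r p.1 p.2) :
    SatisfiesIdentity hr.relFree.{u} p := by
  intro φ
  choose f hf using fun i => hr.proj_surjective.{u} (φ (FreeSemigroup.of i))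
  have : φ = hr.proj.{u}.comp (FreeSemigroup.lift f) := by
    apply FreeSemigroup.hom_ext
    funext i
    simp [hf]
  rw [this]
  exact hr.proj_eq_iff.2 (hr.subst _ hp)

end IsFullyInvariant

/-! ### The equational theory of a variety -/

namespace SemigroupVariety

/-- The congruence of all identities of a variety. -/
def eqs (V : SemigroupVariety.{u}) : Setoid Word where
  r u v := (u, v) ∈ identitiesOf V.carrier
  iseqv := ⟨fun _ _ _ _ => rfl, fun h S hS φ => (h S hS φ).symm,
    fun h h' S hS φ => (h S hS φ).trans (h' S hS φ)⟩

/-- The variety given by all pairs of a relation. -/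
def ofSetoid (r : Setoid Word) : SemigroupVariety.{u} := var {p | r p.1 p.2}

theorem eqs_fullyInvariant (V : SemigroupVariety.{u}) : IsFullyInvariant V.eqs where
  mul_left w u v h S hS φ := by
    have := h S hS φ
    simp_all
  mul_right w u v h S hS φ := by
    have := h S hS φ
    simp_all
  subst ψ u v h S hS φ := h S hS (φ.comp ψ)

theorem ofSetoid_eqs (V : SemigroupVariety.{u}) : ofSetoid V.eqs = V := by
  ext S
  obtain ⟨E, hE⟩ := V.equational
  constructor
  · intro h
    rw [hE]
    intro p hp
    refine h p (fun T hT => ?_)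
    rw [hE] at hT
    exact hT p hp
  · exact fun h p hp => hp S h

/-- No further identities follow: the relatively free semigroup lies in the variety, and `proj`
separates any two unrelated words. -/
theorem eqs_ofSetoid {r : Setoid Word} (hr : IsFullyInvariant r) : (ofSetoid.{u} r).eqs = r := by
  apply le_antisymm
  · intro u v h
    have := h hr.relFree (fun p hp => hr.relFree_satisfies hp) hr.proj
    exact hr.proj_eq_iff.1 this
  · exact fun u v h S hS => hS (u, v) h

theorem eqs_anti {V W : SemigroupVariety.{u}} (h : V ≤ W) : W.eqs ≤ V.eqs :=
  fun _ _ huv S hS => huv S (h hS)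

theorem ofSetoid_anti {r s : Setoid Word} (h : r ≤ s) : ofSetoid.{u} s ≤ ofSetoid r :=
  fun _ hS p hp => hS p (h hp)

theorem eqs_le_iff {V W : SemigroupVariety.{u}} : W.eqs ≤ V.eqs ↔ V ≤ W := by
  refine ⟨fun h => ?_, eqs_anti⟩
  rw [← ofSetoid_eqs V, ← ofSetoid_eqs W]
  exact ofSetoid_anti h

theorem eqs_injective : Function.Injective eqs.{u} := fun _ _ h =>
  le_antisymm (eqs_le_iff.1 h.ge) (eqs_le_iff.1 h.le)

theorem eqs_sup (V W : SemigroupVariety.{u}) : (V ⊔ W).eqs = V.eqs ⊓ W.eqs := by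
  have hf := V.eqs_fullyInvariant.inf W.eqs_fullyInvariant
  apply le_antisymm (le_inf (eqs_anti le_sup_left) (eqs_anti le_sup_right))
  rw [← eqs_ofSetoid.{u} hf]
  apply eqs_anti
  apply sup_le
  · conv_lhs => rw [← ofSetoid_eqs V]
    exact ofSetoid_anti inf_le_left
  · conv_lhs => rw [← ofSetoid_eqs W]
    exact ofSetoid_anti inf_le_right

theorem eqs_inf (V W : SemigroupVariety.{u}) : (V ⊓ W).eqs = V.eqs ⊔ W.eqs := by
  have hf := V.eqs_fullyInvariant.sup W.eqs_fullyInvariant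
  apply le_antisymm _ (sup_le (eqs_anti inf_le_left) (eqs_anti inf_le_right))
  rw [← eqs_ofSetoid.{u} hf]
  apply eqs_anti
  apply le_inf
  · conv_rhs => rw [← ofSetoid_eqs V]
    exact ofSetoid_anti le_sup_left
  · conv_rhs => rw [← ofSetoid_eqs W]
    exact ofSetoid_anti le_sup_right

theorem eqs_top : (⊤ : SemigroupVariety.{u}).eqs = ⊥ := by
  have hf : IsFullyInvariant (⊥ : Setoid Word) :=
    ⟨by rintro w u _ rfl; rfl, by rintro w u _ rfl; rfl, by rintro φ u _ rfl; rfl⟩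
  rw [eq_bot_iff, ← eqs_ofSetoid.{u} hf]
  exact eqs_anti le_top

theorem eqs_var_le {E : Set (Word × Word)} {r : Setoid Word} (hr : IsFullyInvariant r)
    (h : ∀ p ∈ E, r p.1 p.2) : (var.{u} E).eqs ≤ r := by
  rw [← eqs_ofSetoid.{u} hr]
  exact eqs_anti fun S hS p hp => hS p (h p hp)

theorem eqs_var_of_mem {E : Set (Word × Word)} {p : Word × Word} (hp : p ∈ E) :
    (var.{u} E).eqs p.1 p.2 :=
  fun _ hS => hS p hp

end SemigroupVariety

/-! ### Letters of words -/

namespace Word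

theorem letters_of (i : ℕ) : letters (FreeSemigroup.of i) = [i] := rfl

theorem letters_mul (u v : Word) : letters (u * v) = letters u ++ letters v := rfl

theorem letters_ne_nil (u : Word) : letters u ≠ [] := by simp [letters]

theorem letters_injective : Function.Injective letters := by
  rintro ⟨a, l⟩ ⟨b, l'⟩ h
  simp only [letters, List.cons.injEq] at h
  rw [FreeSemigroup.mk.injEq]
  exact h

theorem exists_letters_eq {l : List ℕ} (h : l ≠ []) : ∃ w : Word, w.letters = l := by
  cases l with
  | nil => exact absurd rfl h
  | cons a l => exact ⟨⟨a, l⟩, rfl⟩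

theorem letters_map (f : ℕ → ℕ) (u : Word) :
    letters (FreeSemigroup.map f u) = (letters u).map f := by
  induction u using FreeSemigroup.recOnMul with
  | ih1 x => rfl
  | ih2 x y _ ih => rw [map_mul, letters_mul, letters_mul, ih, List.map_append]; rfl

theorem letters_hom (φ : Word →ₙ* Word) (u : Word) :
    letters (φ u) = (letters u).flatMap fun i => letters (φ (FreeSemigroup.of i)) := by
  induction u using FreeSemigroup.recOnMul with
  | ih1 x => simp [letters_of]
  | ih2 x y _ ih =>
    rw [map_mul, letters_mul, letters_mul, ih, List.flatMap_append]
    simp [letters_of]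

theorem length_letters (u : Word) : u.letters.length = u.length := rfl

theorem map_map (f g : ℕ → ℕ) (u : Word) :
    FreeSemigroup.map f (FreeSemigroup.map g u) = FreeSemigroup.map (f ∘ g) u := by
  apply letters_injective
  simp [letters_map]

theorem map_eq_map_iff {f g : ℕ → ℕ} {u : Word} :
    FreeSemigroup.map f u = FreeSemigroup.map g u ↔ ∀ i ∈ u.letters, f i = g i := by
  rw [← letters_injective.eq_iff, letters_map, letters_map, List.map_inj_left]

/-- Two words are balanced if every letter occurs the same number of times in both. -/
def Bal (u v : Word) : Prop := u.letters.Perm v.letters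

theorem Bal.refl (u : Word) : Bal u u := List.Perm.refl _

theorem Bal.symm {u v : Word} (h : Bal u v) : Bal v u := List.Perm.symm h

theorem Bal.trans {u v w : Word} (h : Bal u v) (h' : Bal v w) : Bal u w := List.Perm.trans h h'

theorem Bal.map {u v : Word} (h : Bal u v) (f : ℕ → ℕ) :
    Bal (FreeSemigroup.map f u) (FreeSemigroup.map f v) := by
  unfold Bal
  rw [letters_map, letters_map]
  exact List.Perm.map f h

theorem Bal.hom {u v : Word} (h : Bal u v) (φ : Word →ₙ* Word) : Bal (φ u) (φ v) := by
  unfold Bal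
  rw [letters_hom, letters_hom φ v]
  exact List.Perm.flatMap_right _ h

theorem Bal.mul_left {u v : Word} (h : Bal u v) (w : Word) : Bal (w * u) (w * v) := by
  unfold Bal
  rw [letters_mul, letters_mul]
  exact List.Perm.append_left _ h

theorem Bal.mul_right {u v : Word} (h : Bal u v) (w : Word) : Bal (u * w) (v * w) := by
  unfold Bal
  rw [letters_mul, letters_mul]
  exact List.Perm.append_right _ h

end Word

/-- All pairs of the relation are balanced. -/
def IsBalanced (r : Setoid Word) : Prop := ∀ {u v : Word}, r u v → Word.Bal u v

theorem IsBalanced.sup {r s : Setoid Word} (hr : IsBalanced r) (hs : IsBalanced s) :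
    IsBalanced (r ⊔ s) := fun h =>
  Setoid.sup_le_of_forall ⟨Word.Bal.refl, Word.Bal.symm, Word.Bal.trans⟩ (fun h => hr h)
    (fun h => hs h) h

namespace SemigroupVariety

/-- Sending a word to its multiset of letters is a homomorphism into a commutative semigroup that
separates unbalanced words. Conversely, a permutation of letters is built from adjacent swaps, which
a commutative semigroup cannot see. -/
theorem COM_le_iff {V : SemigroupVariety.{u}} : COM ≤ V ↔ IsBalanced V.eqs := by
  constructor
  · intro h u v huv
    let S : Semigrp.{u} := Semigrp.of (ULift.{u} (Multiplicative (Multiset ℕ)))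
    have hS : S ∈ COM.carrier := fun a b => ULift.ext _ _ (mul_comm a.down b.down)
    let φ : Word →ₙ* S := ⟨fun w => ULift.up (Multiplicative.ofAdd (w.letters : Multiset ℕ)),
      fun x y => by rw [Word.letters_mul]; rfl⟩
    have h1 : φ u = φ v := huv S (h hS) φ
    have h2 : (u.letters : Multiset ℕ) = v.letters := ULift.up.inj h1
    exact Multiset.coe_eq_coe.1 h2
  · intro h
    rw [← ofSetoid_eqs V]
    rintro S hS ⟨u, v⟩ huv φ
    have hb := h huv
    have key : ∀ l l' : List ℕ, l.Perm l' → ∀ w w' : Word, w.letters = l → w'.letters = l' →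
        φ w = φ w' := by
      intro l l' hl
      induction hl with
      | nil => exact fun w _ hw => absurd hw w.letters_ne_nil
      | @cons x l₁ l₂ hp ih =>
        intro w w' hw hw'
        -- There is no empty word, so an empty tail needs separate treatment.
        rcases eq_or_ne l₁ [] with rfl | hne
        · rw [List.nil_perm.1 hp] at hw'
          rw [Word.letters_injective (hw.trans hw'.symm)]
        · obtain ⟨t, rfl⟩ := Word.exists_letters_eq hne
          have hne' : l₂ ≠ [] := by
            rintro rfl
            exact hne (List.perm_nil.1 hp)
          obtain ⟨t', rfl⟩ := Word.exists_letters_eq hne'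
          have e : w = FreeSemigroup.of x * t := Word.letters_injective (by rw [hw]; rfl)
          have e' : w' = FreeSemigroup.of x * t' := Word.letters_injective (by rw [hw']; rfl)
          rw [e, e', map_mul, map_mul, ih t t' rfl rfl]
      | swap x y l =>
        intro w w' hw hw'
        rcases eq_or_ne l [] with rfl | hne
        · have e : w = FreeSemigroup.of y * FreeSemigroup.of x :=
            Word.letters_injective (by rw [hw]; rfl)
          have e' : w' = FreeSemigroup.of x * FreeSemigroup.of y :=
            Word.letters_injective (by rw [hw']; rfl)
          rw [e, e', map_mul, map_mul]
          exact hS _ _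
        · obtain ⟨t, rfl⟩ := Word.exists_letters_eq hne
          have e : w = FreeSemigroup.of y * FreeSemigroup.of x * t :=
            Word.letters_injective (by rw [hw]; rfl)
          have e' : w' = FreeSemigroup.of x * FreeSemigroup.of y * t :=
            Word.letters_injective (by rw [hw']; rfl)
          rw [e, e', map_mul, map_mul, map_mul, map_mul]
          exact congrArg (· * φ t) (hS _ _)
      | @trans l₁ l₂ l₃ h₁ h₂ ih₁ ih₂ =>
        intro w w' hw hw'
        have hne : l₂ ≠ [] := by
          rintro rfl
          rw [List.perm_nil.1 h₁] at hw
          exact w.letters_ne_nil hw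
        obtain ⟨t, ht⟩ := Word.exists_letters_eq hne
        exact (ih₁ w t hw ht).trans (ih₂ t w' ht hw')
    exact key _ _ hb u v rfl rfl

end SemigroupVariety

/-! ### Neutral elements -/

section SpecialElements

variable {L : Type*} [Lattice L] {x : L}

theorem IsNeutralElement.isStandardElement (h : IsNeutralElement x) : IsStandardElement x := by
  intro y z
  have := h y z z (subset_latticeClosure (by simp)) x (subset_latticeClosure (by simp)) y
    (subset_latticeClosure (by simp))
  rwa [inf_comm, inf_comm x z, inf_comm y z]

theorem IsNeutralElement.isCostandardElement (h : IsNeutralElement x) : IsCostandardElement x := by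
  intro y z
  have hx : x ∈ latticeClosure ({x, y, z} : Set L) := subset_latticeClosure (by simp)
  have hy : y ∈ latticeClosure ({x, y, z} : Set L) := subset_latticeClosure (by simp)
  have hz : z ∈ latticeClosure ({x, y, z} : Set L) := subset_latticeClosure (by simp)
  rw [h y z _ (isSublattice_latticeClosure.supClosed hx hz) y hy z hz, inf_comm (x ⊔ z) y,
    h y z y hy x hx z hz, inf_eq_right.2 (le_sup_right : z ≤ x ⊔ z), sup_assoc,
    sup_eq_right.2 (inf_le_right : y ⊓ z ≤ z), inf_comm]

theorem IsStandardElement.isDistributiveElement (h : IsStandardElement x) :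
    IsDistributiveElement x := by
  intro y z
  rw [h y (x ⊔ z), inf_eq_left.2 (le_sup_left : x ≤ x ⊔ z), inf_comm y (x ⊔ z), h z y, ← sup_assoc,
    sup_eq_left.2 (inf_le_left : x ⊓ y ≤ x), inf_comm]

theorem IsCostandardElement.isCodistributiveElement (h : IsCostandardElement x) :
    IsCodistributiveElement x := by
  intro y z
  rw [h y (x ⊓ z), sup_eq_left.2 (inf_le_left : x ⊓ z ≤ x), sup_comm y (x ⊓ z), h z y, ← inf_assoc,
    inf_eq_left.2 (le_sup_left : x ≤ x ⊔ y), sup_comm]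

end SpecialElements

/-! ### Locally trivial or full relations, and why they are neutral -/

theorem Setoid.eq_of_sup_of_forall_eq {α : Type*} {r s : Setoid α} {a b : α}
    (hr : ∀ c, r a c → c = a) (hs : ∀ c, s a c → c = a) (h : (r ⊔ s) a b) : b = a := by
  have key : Equivalence fun x y : α => (x = a ↔ y = a) :=
    ⟨fun _ => Iff.rfl, fun h => h.symm, fun h h' => h.trans h'⟩
  have aux : ∀ t : Setoid α, (∀ c, t a c → c = a) → ∀ {x y}, t x y → (x = a ↔ y = a) := by
    intro t ht x y hxy
    constructor
    · rintro rfl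
      exact ht _ hxy
    · rintro rfl
      exact ht _ (t.symm' hxy)
  exact (Setoid.sup_le_of_forall key (aux r hr) (aux s hs) h).1 rfl

/-- A relation that is on every class of balanced words either trivial or universal. -/
def IsLocallyTrivialOrFull (r : Setoid Word) : Prop :=
  ∀ ⦃a b : Word⦄, r a b → a ≠ b → ∀ u : Word, Word.Bal a u → r a u

/-- A word moved by the join is already moved by one of the two relations, and that one is full on
its class. -/
theorem IsLocallyTrivialOrFull.sup {r s : Setoid Word} (hr : IsLocallyTrivialOrFull r)
    (hs : IsLocallyTrivialOrFull s) : IsLocallyTrivialOrFull (r ⊔ s) := by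
  intro a b h hne u hu
  by_cases h₁ : ∀ c, r a c → c = a
  · by_cases h₂ : ∀ c, s a c → c = a
    · exact absurd (Setoid.eq_of_sup_of_forall_eq h₁ h₂ h).symm hne
    · push Not at h₂
      obtain ⟨c, hc, hca⟩ := h₂
      exact Setoid.rel_sup_right (hs hc hca.symm u hu)
  · push Not at h₁
    obtain ⟨c, hc, hca⟩ := h₁
    exact Setoid.rel_sup_left (hr hc hca.symm u hu)

/-- The restriction of a relation to the words that are balanced with `w`. -/
def Setoid.restrict (w : Word) (r : Setoid Word) : Setoid {u : Word // Word.Bal w u} :=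
  r.comap Subtype.val

theorem Setoid.restrict_inf (w : Word) (r s : Setoid Word) :
    (r ⊓ s).restrict w = r.restrict w ⊓ s.restrict w := rfl

/-- Balanced relations never leave a balance class, so chains that witness the join stay inside. The
auxiliary equivalence says that both ends are inside and joined there, or both are outside. -/
theorem Setoid.restrict_sup (w : Word) {r s : Setoid Word} (hr : IsBalanced r)
    (hs : IsBalanced s) : (r ⊔ s).restrict w = r.restrict w ⊔ s.restrict w := by
  apply le_antisymm
  · rintro ⟨x, hx⟩ ⟨y, hy⟩ h
    have aux : ∀ t : Setoid Word, IsBalanced t → t.restrict w ≤ r.restrict w ⊔ s.restrict w →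
        ∀ {x y}, t x y → ((∃ hx : Word.Bal w x, ∃ hy : Word.Bal w y,
          (r.restrict w ⊔ s.restrict w) ⟨x, hx⟩ ⟨y, hy⟩) ∨ (¬ Word.Bal w x ∧ ¬ Word.Bal w y)) := by
      intro t ht hle x y hxy
      by_cases hx : Word.Bal w x
      · have hy := hx.trans (ht hxy)
        exact Or.inl ⟨hx, hy, hle (x := ⟨x, hx⟩) (y := ⟨y, hy⟩) hxy⟩
      · exact Or.inr ⟨hx, fun hy => hx (hy.trans (ht hxy).symm)⟩
    have := Setoid.sup_le_of_forall (P := fun x y => (∃ hx : Word.Bal w x, ∃ hy : Word.Bal w y,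
          (r.restrict w ⊔ s.restrict w) ⟨x, hx⟩ ⟨y, hy⟩) ∨ (¬ Word.Bal w x ∧ ¬ Word.Bal w y))
      ⟨?_, ?_, ?_⟩ (aux r hr le_sup_left) (aux s hs le_sup_right) h
    · rcases this with ⟨_, _, h⟩ | h
      · exact h
      · exact absurd hx h.1
    · intro x
      by_cases hx : Word.Bal w x
      · exact Or.inl ⟨hx, hx, Setoid.refl' _ _⟩
      · exact Or.inr ⟨hx, hx⟩
    · rintro x y (⟨hx, hy, h⟩ | h)
      · exact Or.inl ⟨hy, hx, Setoid.symm' _ h⟩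
      · exact Or.inr h.symm
    · rintro x y z (⟨hx, hy, h⟩ | h) (⟨hy', hz, h'⟩ | h')
      · exact Or.inl ⟨hx, hz, Setoid.trans' _ h h'⟩
      · exact absurd hy h'.1
      · exact absurd hy' h.2
      · exact Or.inr ⟨h.1, h'.2⟩
  · exact sup_le (fun _ _ h => Setoid.rel_sup_left (r := r) h)
      (fun _ _ h => Setoid.rel_sup_right (s := s) h)

theorem Setoid.eq_of_restrict_eq {r s : Setoid Word} (hr : IsBalanced r) (hs : IsBalanced s)
    (h : ∀ w, r.restrict w = s.restrict w) : r = s := by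
  have aux : ∀ {r s : Setoid Word}, IsBalanced r → (∀ w, r.restrict w = s.restrict w) → r ≤ s := by
    intro r s hr h x y hxy
    have : (r.restrict x) ⟨x, Word.Bal.refl x⟩ ⟨y, hr hxy⟩ := hxy
    rw [h x] at this
    exact this
  exact le_antisymm (aux hr h) (aux hs fun w => (h w).symm)

theorem IsLocallyTrivialOrFull.restrict {r : Setoid Word} (h : IsLocallyTrivialOrFull r)
    (w : Word) : r.restrict w = ⊥ ∨ r.restrict w = ⊤ := by
  by_cases hw : ∃ a b, r a b ∧ a ≠ b ∧ Word.Bal w a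
  · right
    obtain ⟨a, b, hab, hne, ha⟩ := hw
    rw [Setoid.eq_top_iff]
    rintro ⟨x, hx⟩ ⟨y, hy⟩
    exact r.trans' (r.symm' (h hab hne x (ha.symm.trans hx))) (h hab hne y (ha.symm.trans hy))
  · left
    push Not at hw
    rw [eq_bot_iff]
    rintro ⟨x, hx⟩ ⟨y, hy⟩ hxy
    by_contra hne
    exact hw x y hxy (fun e => hne (Subtype.ext e)) hx

/-- The sublattice generated by `y`, `z` and both bounds. -/
def boundedClosurePair {L : Type*} [Lattice L] [BoundedOrder L] (y z : L) : Set L :=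
  {⊥, ⊤, y, z, y ⊓ z, y ⊔ z}

section BoundedClosurePair

variable {L : Type*} [Lattice L] [BoundedOrder L] {y z a b c : L}

theorem sup_mem_boundedClosurePair (ha : a ∈ boundedClosurePair y z)
    (hb : b ∈ boundedClosurePair y z) : a ⊔ b ∈ boundedClosurePair y z := by
  have h₁ : z ⊔ y = y ⊔ z := sup_comm _ _
  have h₂ : y ⊓ z ⊔ z = z := sup_eq_right.2 inf_le_right
  have h₃ : z ⊔ y ⊓ z = z := sup_eq_left.2 inf_le_right
  have h₄ : y ⊓ z ⊔ (y ⊔ z) = y ⊔ z := sup_eq_right.2 (inf_le_left.trans le_sup_left)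
  have h₅ : y ⊔ z ⊔ y ⊓ z = y ⊔ z := sup_eq_left.2 (inf_le_left.trans le_sup_left)
  have h₆ : y ⊓ z ⊔ y = y := sup_eq_right.2 inf_le_left
  have h₇ : z ⊔ (y ⊔ z) = y ⊔ z := sup_eq_right.2 le_sup_right
  have h₈ : y ⊔ z ⊔ y = y ⊔ z := sup_eq_left.2 le_sup_left
  rcases ha with rfl | rfl | rfl | rfl | rfl | rfl <;>
    rcases hb with rfl | rfl | rfl | rfl | rfl | rfl <;>
    simp [boundedClosurePair, *]

theorem inf_mem_boundedClosurePair (ha : a ∈ boundedClosurePair y z)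
    (hb : b ∈ boundedClosurePair y z) : a ⊓ b ∈ boundedClosurePair y z := by
  have h₁ : z ⊓ y = y ⊓ z := inf_comm _ _
  have h₂ : (y ⊔ z) ⊓ z = z := inf_eq_right.2 le_sup_right
  have h₃ : z ⊓ (y ⊔ z) = z := inf_eq_left.2 le_sup_right
  have h₄ : (y ⊔ z) ⊓ (y ⊓ z) = y ⊓ z := inf_eq_right.2 (inf_le_left.trans le_sup_left)
  have h₅ : y ⊓ z ⊓ (y ⊔ z) = y ⊓ z := inf_eq_left.2 (inf_le_left.trans le_sup_left)
  have h₆ : (y ⊔ z) ⊓ y = y := inf_eq_right.2 le_sup_left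
  have h₇ : z ⊓ (y ⊓ z) = y ⊓ z := inf_eq_right.2 inf_le_right
  have h₈ : y ⊓ z ⊓ y = y ⊓ z := inf_eq_left.2 inf_le_left
  rcases ha with rfl | rfl | rfl | rfl | rfl | rfl <;>
    rcases hb with rfl | rfl | rfl | rfl | rfl | rfl <;>
    simp [boundedClosurePair, *]

/-- Among the six elements only `y` and `z` can be incomparable, so the law needs a real check only
at `y ⊓ z`. -/
theorem sup_inf_of_mem_boundedClosurePair (ha : a ∈ boundedClosurePair y z)
    (hb : b ∈ boundedClosurePair y z) (hc : c ∈ boundedClosurePair y z) :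
    a ⊔ b ⊓ c = (a ⊔ b) ⊓ (a ⊔ c) := by
  have hle : ∀ b c : L, b ≤ c → a ⊔ b ⊓ c = (a ⊔ b) ⊓ (a ⊔ c) := fun b c h => by
    rw [inf_eq_left.2 h, inf_eq_left.2 (sup_le_sup_left h a)]
  have hyz : a ⊔ y ⊓ z = (a ⊔ y) ⊓ (a ⊔ z) := by
    have h₁ : y ⊓ z ⊔ z = z := sup_eq_right.2 inf_le_right
    have h₂ : z ⊔ y ⊓ z = z := sup_eq_left.2 inf_le_right
    have h₃ : y ⊔ z ⊔ y ⊓ z = y ⊔ z := sup_eq_left.2 (inf_le_left.trans le_sup_left)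
    have h₄ : (z ⊔ y) ⊓ z = z := inf_eq_right.2 le_sup_left
    have h₅ : y ⊓ z ⊔ y = y := sup_eq_right.2 inf_le_left
    have h₆ : y ⊔ z ⊔ y = y ⊔ z := sup_eq_left.2 le_sup_left
    rcases ha with rfl | rfl | rfl | rfl | rfl | rfl <;> simp [*]
  have hcmp : b ≤ c ∨ c ≤ b ∨ (b = y ∧ c = z) ∨ (b = z ∧ c = y) := by
    have h₁ : y ⊓ z ≤ y ⊔ z := inf_le_left.trans le_sup_left
    rcases hb with rfl | rfl | rfl | rfl | rfl | rfl <;>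
      rcases hc with rfl | rfl | rfl | rfl | rfl | rfl <;> simp [h₁]
  rcases hcmp with h | h | ⟨rfl, rfl⟩ | ⟨rfl, rfl⟩
  · exact hle b c h
  · rw [inf_comm b, inf_comm (a ⊔ b)]
    exact hle c b h
  · exact hyz
  · rw [inf_comm b, inf_comm (a ⊔ b)]
    exact hyz

end BoundedClosurePair

/-- Restrictions to balance classes are lattice homomorphisms up to duality and jointly injective.
On each class, everything generated by the three elements lands in `boundedClosurePair`, where
distributivity is known. -/
theorem isNeutralElement_of_isLocallyTrivialOrFull {V : OC.{u}}
    (hV : IsLocallyTrivialOrFull V.1.eqs) : IsNeutralElement V := by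
  intro Y Z
  have hbal : ∀ A : OC.{u}, IsBalanced A.1.eqs := fun A => SemigroupVariety.COM_le_iff.1 A.2
  have hinf : ∀ (w : Word) (A B : OC.{u}), (A ⊓ B).1.eqs.restrict w =
      A.1.eqs.restrict w ⊔ B.1.eqs.restrict w := fun w A B => by
    rw [show (A ⊓ B).1 = A.1 ⊓ B.1 from rfl, SemigroupVariety.eqs_inf,
      Setoid.restrict_sup w (hbal A) (hbal B)]
  have hsup : ∀ (w : Word) (A B : OC.{u}), (A ⊔ B).1.eqs.restrict w =
      A.1.eqs.restrict w ⊓ B.1.eqs.restrict w := fun w A B => by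
    rw [show (A ⊔ B).1 = A.1 ⊔ B.1 from rfl, SemigroupVariety.eqs_sup, Setoid.restrict_inf]
  let T : Set OC.{u} := {A | ∀ w, A.1.eqs.restrict w ∈
    boundedClosurePair (Y.1.eqs.restrict w) (Z.1.eqs.restrict w)}
  have hT : latticeClosure ({V, Y, Z} : Set OC.{u}) ⊆ T := by
    apply latticeClosure_min
    · rintro A (rfl | rfl | rfl) w
      · rcases hV.restrict w with h | h <;> rw [h] <;> simp [boundedClosurePair]
      · simp [boundedClosurePair]
      · simp [boundedClosurePair]
    · constructor
      · intro A hA B hB w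
        rw [hsup]
        exact inf_mem_boundedClosurePair (hA w) (hB w)
      · intro A hA B hB w
        rw [hinf]
        exact sup_mem_boundedClosurePair (hA w) (hB w)
  intro a ha b hb c hc
  apply Subtype.ext
  apply SemigroupVariety.eqs_injective
  apply Setoid.eq_of_restrict_eq (hbal _) (hbal _)
  intro w
  rw [hinf, hsup, hsup, hinf, hinf]
  exact sup_inf_of_mem_boundedClosurePair (hT ha w) (hT hb w) (hT hc w)

/-! ### Congruences concentrated on one class of balanced words -/

namespace Word

theorem Bal.mem_iff {u v : Word} (h : Bal u v) {i : ℕ} : i ∈ u.letters ↔ i ∈ v.letters :=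
  List.Perm.mem_iff h

theorem Bal.length_eq {u v : Word} (h : Bal u v) : u.length = v.length := List.Perm.length_eq h

theorem Bal.content_eq {u v : Word} (h : Bal u v) : u.content = v.content :=
  List.toFinset_eq_of_perm _ _ h

theorem mem_content {u : Word} {i : ℕ} : i ∈ u.content ↔ i ∈ u.letters := List.mem_toFinset

theorem content_map (f : ℕ → ℕ) (u : Word) :
    content (FreeSemigroup.map f u) = u.content.image f := by
  ext i
  simp [mem_content, letters_map]

theorem length_map (f : ℕ → ℕ) (u : Word) : (FreeSemigroup.map f u).length = u.length :=
  FreeSemigroup.length_map f u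

/-- A word is longer than `a`, or of the same length with fewer letters. -/
def Exceeds (a u : Word) : Prop :=
  a.length < u.length ∨ u.length = a.length ∧ u.content.card < a.content.card

theorem Exceeds.of_bal {a u v : Word} (h : Exceeds a u) (hb : Bal u v) : Exceeds a v := by
  rwa [Exceeds, ← hb.length_eq, ← hb.content_eq]

theorem length_le_length_hom (φ : Word →ₙ* Word) (u : Word) : u.length ≤ (φ u).length := by
  induction u using FreeSemigroup.recOnMul with
  | ih1 x => exact Nat.le_add_left 1 _
  | ih2 x y h₁ h₂ =>
    rw [map_mul, FreeSemigroup.length_mul, FreeSemigroup.length_mul]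
    exact Nat.add_le_add h₁ h₂

theorem hom_eq_map_of_forall {φ : Word →ₙ* Word} {f : ℕ → ℕ} {u : Word}
    (h : ∀ i ∈ u.letters, φ (FreeSemigroup.of i) = FreeSemigroup.of (f i)) :
    φ u = FreeSemigroup.map f u := by
  apply letters_injective
  rw [letters_hom, letters_map, ← List.flatMap_singleton' (List.map f u.letters),
    List.flatMap_map]
  refine List.flatMap_congr fun i hi => ?_
  rw [h i hi]
  rfl

theorem length_lt_length_hom {φ : Word →ₙ* Word} {u : Word} {i : ℕ} (hi : i ∈ u.letters)
    (h : 1 < (φ (FreeSemigroup.of i)).length) : u.length < (φ u).length := by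
  induction u using FreeSemigroup.recOnMul with
  | ih1 x =>
    rw [letters_of, List.mem_singleton] at hi
    exact hi ▸ h
  | ih2 x y h₁ h₂ =>
    rw [letters_mul, List.mem_append] at hi
    rw [map_mul, FreeSemigroup.length_mul, FreeSemigroup.length_mul]
    have hx := length_le_length_hom φ (FreeSemigroup.of x)
    have hy := length_le_length_hom φ y
    rcases hi with hi | hi
    · exact Nat.add_lt_add_of_lt_of_le (h₁ hi) hy
    · exact Nat.add_lt_add_of_le_of_lt hx (h₂ hi)

/-- A substitution either lengthens a word or acts on it by renaming its letters. -/
theorem length_lt_or_forall_of (φ : Word →ₙ* Word) (u : Word) :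
    u.length < (φ u).length ∨
      ∃ f : ℕ → ℕ, ∀ i ∈ u.letters, φ (FreeSemigroup.of i) = FreeSemigroup.of (f i) := by
  by_cases h : ∃ i ∈ u.letters, 1 < (φ (FreeSemigroup.of i)).length
  · obtain ⟨i, hi, h⟩ := h
    exact Or.inl (length_lt_length_hom hi h)
  · push Not at h
    refine Or.inr ⟨fun i => (φ (FreeSemigroup.of i)).head, fun i hi => ?_⟩
    have hl := h i hi
    apply letters_injective
    rw [← length_letters, letters, List.length_cons] at hl
    rw [letters_of, letters, List.eq_nil_of_length_eq_zero (l := (φ (FreeSemigroup.of i)).tail)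
      (by omega)]

end Word

open Word

/-- A relation between balanced words with as many letters and of the same length as `a` that is
invariant under renaming of letters. -/
structure IsRenamingInvariant (a : Word) (r : Setoid Word) : Prop where
  map : ∀ {f : ℕ → ℕ} {u v : Word}, Set.InjOn f {i | i ∈ u.letters} → r u v →
    r (FreeSemigroup.map f u) (FreeSemigroup.map f v)
  bal : IsBalanced r
  level : ∀ {u v : Word}, r u v → u = v ∨ u.length = a.length ∧ u.content.card = a.content.card

namespace IsRenamingInvariant

variable {a : Word} {r : Setoid Word}

/-- The least extension that is universal on all balanced words exceeding `a`. -/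
def extension (hr : IsRenamingInvariant a r) : Setoid Word where
  r u v := r u v ∨ Bal u v ∧ Exceeds a u
  iseqv := by
    refine ⟨fun u => Or.inl (r.refl' u), ?_, ?_⟩
    · rintro u v (h | ⟨h, h'⟩)
      · exact Or.inl (r.symm' h)
      · exact Or.inr ⟨h.symm, h'.of_bal h⟩
    · rintro u v w (h | ⟨h, h'⟩) (h₁ | ⟨h₁, h₁'⟩)
      · exact Or.inl (r.trans' h h₁)
      · exact Or.inr ⟨(hr.bal h).trans h₁, h₁'.of_bal (hr.bal h).symm⟩
      · exact Or.inr ⟨h.trans (hr.bal h₁), h'⟩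
      · exact Or.inr ⟨h.trans h₁, h'⟩

theorem extension_balanced (hr : IsRenamingInvariant a r) : IsBalanced hr.extension := by
  rintro u v (h | h)
  · exact hr.bal h
  · exact h.1

theorem extension_iff (hr : IsRenamingInvariant a r) {u v : Word} (h : Bal a u) :
    hr.extension u v ↔ r u v := by
  refine ⟨?_, Or.inl⟩
  rintro (h' | ⟨_, h' | h'⟩)
  · exact h'
  · exact absurd h.length_eq h'.ne
  · exact absurd (congrArg Finset.card h.content_eq) h'.2.ne'

/-- Multiplication and lengthening substitutions lead to longer words, and non-injective renamings
to fewer letters; in both cases the extension is full there. Only injective renamings remain, and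
they preserve `r`. -/
theorem extension_fullyInvariant (hr : IsRenamingInvariant a r) :
    IsFullyInvariant hr.extension := by
  have hlen : ∀ {u v}, hr.extension u v → u = v ∨ a.length ≤ u.length := by
    rintro u v (h | ⟨_, h | h⟩)
    · exact (hr.level h).imp_right fun h => h.1.ge
    · exact Or.inr h.le
    · exact Or.inr h.1.ge
  have pos : ∀ w : Word, 0 < w.length := fun w => Nat.succ_pos _
  refine ⟨fun w u v h => ?_, fun w u v h => ?_, fun φ u v h => ?_⟩
  · rcases hlen h with rfl | hl
    · exact Setoid.refl' _ _
    · refine Or.inr ⟨(hr.extension_balanced h).mul_left w, Or.inl ?_⟩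
      rw [FreeSemigroup.length_mul]
      have := pos w
      omega
  · rcases hlen h with rfl | hl
    · exact Setoid.refl' _ _
    · refine Or.inr ⟨(hr.extension_balanced h).mul_right w, Or.inl ?_⟩
      rw [FreeSemigroup.length_mul]
      have := pos w
      omega
  · have hb := hr.extension_balanced h
    rcases hlen h with rfl | hl
    · exact Setoid.refl' _ _
    rcases length_lt_or_forall_of φ u with h' | ⟨f, hf⟩
    · exact Or.inr ⟨hb.hom φ, Or.inl (hl.trans_lt h')⟩
    have hu : φ u = FreeSemigroup.map f u := hom_eq_map_of_forall hf
    have hv : φ v = FreeSemigroup.map f v :=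
      hom_eq_map_of_forall fun i hi => hf i (hb.mem_iff.2 hi)
    rw [hu, hv]
    have hcard : (content (FreeSemigroup.map f u)).card ≤ u.content.card := by
      rw [content_map]
      exact Finset.card_image_le
    rcases h with h | ⟨_, h | ⟨h, h'⟩⟩
    · by_cases hinj : Set.InjOn f {i | i ∈ u.letters}
      · exact Or.inl (hr.map hinj h)
      · rcases hr.level h with rfl | ⟨h₁, h₂⟩
        · exact Setoid.refl' _ _
        refine Or.inr ⟨hb.map f, Or.inr ⟨by rw [length_map, h₁], ?_⟩⟩
        rw [← h₂, content_map]
        refine lt_of_le_of_ne Finset.card_image_le fun he => hinj ?_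
        have := Finset.card_image_iff.1 he
        intro i hi j hj
        exact this (mem_content.2 hi) (mem_content.2 hj)
    · exact Or.inr ⟨hb.map f, Or.inl (by rwa [length_map])⟩
    · exact Or.inr ⟨hb.map f, Or.inr ⟨by rwa [length_map], hcard.trans_lt h'⟩⟩

end IsRenamingInvariant

/-! ### Distributive and codistributive elements -/

/-- One of the two distributive laws with `r` in the distinguished place holds for all pairs of
balanced fully invariant congruences. -/
def IsSemidistributive (r : Setoid Word) : Prop :=
  ∀ s t : Setoid Word, IsFullyInvariant s → IsBalanced s → IsFullyInvariant t → IsBalanced t →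
    r ⊓ (s ⊔ t) ≤ r ⊓ s ⊔ r ⊓ t ∨ (r ⊔ s) ⊓ (r ⊔ t) ≤ r ⊔ s ⊓ t

-- Because equational theories reverse the order, distributivity yields the law for the meet of `r`
-- with a join. The codistributive case below yields the other alternative.
open SemigroupVariety in
theorem IsDistributiveElement.isSemidistributive {V : OC.{u}} (h : IsDistributiveElement V) :
    IsSemidistributive V.1.eqs := by
  intro s t hs hsb ht htb
  left
  have := congrArg (fun A : OC.{u} => A.1.eqs)
    (h ⟨ofSetoid s, COM_le_iff.2 (by rwa [eqs_ofSetoid hs])⟩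
      ⟨ofSetoid t, COM_le_iff.2 (by rwa [eqs_ofSetoid ht])⟩)
  change (V.1 ⊔ (ofSetoid s ⊓ ofSetoid t)).eqs =
    ((V.1 ⊔ ofSetoid s) ⊓ (V.1 ⊔ ofSetoid t)).eqs at this
  simp only [eqs_sup, eqs_inf, eqs_ofSetoid hs, eqs_ofSetoid ht] at this
  exact this.le

open SemigroupVariety in
theorem IsCodistributiveElement.isSemidistributive {V : OC.{u}} (h : IsCodistributiveElement V) :
    IsSemidistributive V.1.eqs := by
  intro s t hs hsb ht htb
  right
  have := congrArg (fun A : OC.{u} => A.1.eqs)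
    (h ⟨ofSetoid s, COM_le_iff.2 (by rwa [eqs_ofSetoid hs])⟩
      ⟨ofSetoid t, COM_le_iff.2 (by rwa [eqs_ofSetoid ht])⟩)
  change (V.1 ⊓ (ofSetoid s ⊔ ofSetoid t)).eqs =
    ((V.1 ⊓ ofSetoid s) ⊔ (V.1 ⊓ ofSetoid t)).eqs at this
  simp only [eqs_sup, eqs_inf, eqs_ofSetoid hs, eqs_ofSetoid ht] at this
  exact this.ge

/-- Along a chain from `a`, balance keeps every word in the class of `a`, where the steps by `r` are
idle. -/
theorem rel_of_sup_of_trivial {r s : Setoid Word} {a b : Word} (hs : IsBalanced s)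
    (hr : ∀ x y, Bal a x → r x y → x = y) (h : (r ⊔ s) a b) : s a b := by
  have key : Equivalence fun x y : Word =>
      (Bal a x → Bal a y ∧ s x y) ∧ (Bal a y → Bal a x ∧ s x y) := by
    refine ⟨fun x => ⟨fun h => ⟨h, s.refl' x⟩, fun h => ⟨h, s.refl' x⟩⟩, ?_, ?_⟩
    · exact fun h => ⟨fun h' => ⟨(h.2 h').1, s.symm' (h.2 h').2⟩,
        fun h' => ⟨(h.1 h').1, s.symm' (h.1 h').2⟩⟩
    · exact fun h h₁ => ⟨fun h' => ⟨(h₁.1 (h.1 h').1).1, s.trans' (h.1 h').2 (h₁.1 (h.1 h').1).2⟩,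
        fun h' => ⟨(h.2 (h₁.2 h').1).1, s.trans' (h.2 (h₁.2 h').1).2 (h₁.2 h').2⟩⟩
  refine ((Setoid.sup_le_of_forall key ?_ ?_ h).1 (Bal.refl a)).2
  · intro x y hxy
    constructor
    · intro hx
      obtain rfl := hr x y hx hxy
      exact ⟨hx, s.refl' _⟩
    · intro hy
      obtain rfl := hr y x hy (r.symm' hxy)
      exact ⟨hy, s.refl' _⟩
  · exact fun hxy => ⟨fun hx => ⟨hx.trans (hs hxy), hxy⟩, fun hy => ⟨hy.trans (hs hxy).symm, hxy⟩⟩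

/-- The triangle `a`, `b`, `c` has its sides in `r`, `s`, `t`. Under the first law the pair `(a, b)`
is tested: `r ⊓ s` contributes nothing, so `t` must relate it. Under the second, `(a, c)` is tested:
`s ⊓ t` contributes nothing, so `r` must relate it. -/
theorem IsSemidistributive.rel_or_rel {r s t : Setoid Word} (hd : IsSemidistributive r)
    (hrb : IsBalanced r) {a b c : Word} (hs : IsRenamingInvariant a s)
    (ht : IsRenamingInvariant a t) (hab : r a b) (hac : s a c) (hcb : t c b)
    (hst : ∀ x y, Bal a x → s x y → t x y → x = y)
    (hrs : ∀ x y, Bal a x → r x y → s x y → x = y) : t a b ∨ r a c := by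
  rcases hd hs.extension ht.extension hs.extension_fullyInvariant hs.extension_balanced
    ht.extension_fullyInvariant ht.extension_balanced with h | h
  · left
    have h₁ : (r ⊓ (hs.extension ⊔ ht.extension)) a b :=
      ⟨hab, Setoid.trans' _ (Setoid.rel_sup_left (Or.inl hac)) (Setoid.rel_sup_right (Or.inl hcb))⟩
    have h₂ := rel_of_sup_of_trivial (r := r ⊓ hs.extension) (s := r ⊓ ht.extension)
      (fun h => hrb h.1)
      (fun x y hx hxy => hrs x y hx hxy.1 ((hs.extension_iff hx).1 hxy.2)) (h h₁)
    exact (ht.extension_iff (Bal.refl a)).1 h₂.2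
  · right
    have h₁ : ((r ⊔ hs.extension) ⊓ (r ⊔ ht.extension)) a c :=
      ⟨Setoid.rel_sup_right (Or.inl hac), Setoid.trans' _ (Setoid.rel_sup_left hab)
        (Setoid.rel_sup_right (Or.inl (t.symm' hcb)))⟩
    have h₂ := h h₁
    rw [sup_comm] at h₂
    exact rel_of_sup_of_trivial (r := hs.extension ⊓ ht.extension) hrb (fun x y hx hxy => hst x y hx
      ((hs.extension_iff hx).1 hxy.1) ((ht.extension_iff hx).1 hxy.2)) h₂

/-! ### Words that differ by a renaming of letters -/

namespace Word

/-- `v` arises from `u` by an injective renaming of letters. -/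
def Renames (u v : Word) : Prop :=
  ∃ f : ℕ → ℕ, Set.InjOn f {i | i ∈ u.letters} ∧ v = FreeSemigroup.map f u

theorem exists_map_map_eq {f : ℕ → ℕ} {u : Word} (hf : Set.InjOn f {i | i ∈ u.letters}) :
    ∃ g : ℕ → ℕ, Set.InjOn g {i | i ∈ letters (FreeSemigroup.map f u)} ∧
      ∀ i ∈ u.letters, g (f i) = i := by
  have h : Set.LeftInvOn (Function.invFunOn f {i | i ∈ u.letters}) f {i | i ∈ u.letters} :=
    hf.leftInvOn_invFunOn
  refine ⟨_, ?_, fun i hi => h hi⟩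
  rintro _ hi _ hj
  rw [Set.mem_ofPred_eq, letters_map, List.mem_map] at hi hj
  obtain ⟨i, hi, rfl⟩ := hi
  obtain ⟨j, hj, rfl⟩ := hj
  rw [h hi, h hj]
  rintro rfl
  rfl

theorem map_map_eq_self {f g : ℕ → ℕ} {u : Word} (h : ∀ i ∈ u.letters, g (f i) = i) :
    FreeSemigroup.map g (FreeSemigroup.map f u) = u := by
  rw [map_map]
  apply letters_injective
  rw [letters_map]
  conv_rhs => rw [← List.map_id u.letters]
  exact List.map_congr_left h

theorem Renames.refl (u : Word) : Renames u u :=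
  ⟨id, Set.injOn_id _, (map_map_eq_self (f := id) (g := id) fun _ _ => rfl).symm.trans
    (by rw [map_map]; rfl)⟩

theorem Renames.symm {u v : Word} (h : Renames u v) : Renames v u := by
  obtain ⟨f, hf, rfl⟩ := h
  obtain ⟨g, hg, hgf⟩ := exists_map_map_eq hf
  exact ⟨g, hg, (map_map_eq_self hgf).symm⟩

theorem Renames.trans {u v w : Word} (h : Renames u v) (h' : Renames v w) : Renames u w := by
  obtain ⟨f, hf, rfl⟩ := h
  obtain ⟨g, hg, rfl⟩ := h'
  refine ⟨g ∘ f, hg.comp hf fun i hi => ?_, map_map _ _ _⟩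
  rw [Set.mem_ofPred_eq, letters_map]
  exact List.mem_map_of_mem hi

theorem map_congr {f g : ℕ → ℕ} {u v : Word} (hb : Bal u v)
    (h : FreeSemigroup.map f u = FreeSemigroup.map g u) :
    FreeSemigroup.map f v = FreeSemigroup.map g v :=
  map_eq_map_iff.2 fun i hi => map_eq_map_iff.1 h i (hb.mem_iff.2 hi)

theorem map_injOn {f : ℕ → ℕ} {u v : Word} (hb : Bal u v) (hf : Set.InjOn f {i | i ∈ u.letters})
    (h : FreeSemigroup.map f u = FreeSemigroup.map f v) : u = v := by
  obtain ⟨g, -, hg⟩ := exists_map_map_eq hf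
  rw [← map_map_eq_self hg, h, map_map_eq_self fun i hi => hg i (hb.mem_iff.2 hi)]

theorem content_card_map {f : ℕ → ℕ} {u : Word} (hf : Set.InjOn f {i | i ∈ u.letters}) :
    (content (FreeSemigroup.map f u)).card = u.content.card := by
  rw [content_map]
  exact Finset.card_image_of_injOn fun i hi j hj => hf (mem_content.1 hi) (mem_content.1 hj)

end Word

theorem IsFullyInvariant.map {r : Setoid Word} (hr : IsFullyInvariant r) (f : ℕ → ℕ) {u v : Word}
    (h : r u v) : r (FreeSemigroup.map f u) (FreeSemigroup.map f v) := hr.subst _ h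

theorem IsFullyInvariant.rel_of_map {r : Setoid Word} (hr : IsFullyInvariant r) {f : ℕ → ℕ}
    {u v : Word} (hb : Bal u v) (hf : Set.InjOn f {i | i ∈ u.letters})
    (h : r (FreeSemigroup.map f u) (FreeSemigroup.map f v)) : r u v := by
  obtain ⟨g, -, hg⟩ := exists_map_map_eq hf
  have := hr.map g h
  rwa [map_map_eq_self hg, map_map_eq_self fun i hi => hg i (hb.mem_iff.2 hi)] at this

/-- The renaming invariant relation generated by a pair of words that are not renamings of each
other. -/
def pairSetoid {a c : Word} (hb : Bal a c) (hac : ¬ Renames a c) : Setoid Word where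
  r u v := u = v ∨ ∃ f : ℕ → ℕ, Set.InjOn f {i | i ∈ a.letters} ∧
    (u = FreeSemigroup.map f a ∧ v = FreeSemigroup.map f c ∨
      u = FreeSemigroup.map f c ∧ v = FreeSemigroup.map f a)
  iseqv := by
    have hset : {i | i ∈ a.letters} = {i | i ∈ c.letters} := Set.ext fun i => hb.mem_iff
    -- Images of `a` and of `c` never coincide, so classes have at most two elements; this is what
    -- makes the relation transitive.
    have hne : ∀ f g : ℕ → ℕ, Set.InjOn f {i | i ∈ a.letters} →
        Set.InjOn g {i | i ∈ a.letters} → FreeSemigroup.map f a ≠ FreeSemigroup.map g c := by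
      intro f g hf hg h
      have h₁ : Renames a (FreeSemigroup.map f a) := ⟨f, hf, rfl⟩
      have h₂ : Renames c (FreeSemigroup.map g c) := ⟨g, hset ▸ hg, rfl⟩
      exact hac (h₁.trans (h ▸ h₂.symm))
    refine ⟨fun _ => Or.inl rfl, ?_, ?_⟩
    · rintro u v (h | ⟨f, hf, h⟩)
      · exact Or.inl h.symm
      · exact Or.inr ⟨f, hf, h.symm.imp (fun h => h.symm) fun h => h.symm⟩
    · rintro u v w (rfl | ⟨f, hf, h⟩) (rfl | ⟨g, hg, h'⟩)
      · exact Or.inl rfl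
      · exact Or.inr ⟨g, hg, h'⟩
      · exact Or.inr ⟨f, hf, h⟩
      · left
        rcases h with ⟨rfl, rfl⟩ | ⟨rfl, rfl⟩ <;> rcases h' with ⟨h', rfl⟩ | ⟨h', rfl⟩
        · exact absurd h'.symm (hne g f hg hf)
        · exact map_congr hb.symm h'
        · exact map_congr hb h'
        · exact absurd h' (hne f g hf hg)

theorem pairSetoid_invariant {a c : Word} (hb : Bal a c) (hac : ¬ Renames a c) :
    IsRenamingInvariant a (pairSetoid hb hac) where
  map := by
    rintro g u v hg (rfl | ⟨f, hf, h⟩)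
    · exact Or.inl rfl
    · refine Or.inr ⟨g ∘ f, ?_, ?_⟩
      · refine Set.InjOn.comp hg hf fun i hi => ?_
        rcases h with ⟨rfl, -⟩ | ⟨rfl, -⟩
        · rw [Set.mem_ofPred_eq, letters_map]
          exact List.mem_map_of_mem hi
        · rw [Set.mem_ofPred_eq, letters_map]
          exact List.mem_map_of_mem (hb.mem_iff.1 hi)
      · rw [← map_map, ← map_map]
        rcases h with ⟨rfl, rfl⟩ | ⟨rfl, rfl⟩
        · exact Or.inl ⟨rfl, rfl⟩
        · exact Or.inr ⟨rfl, rfl⟩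
  bal := by
    rintro u v (rfl | ⟨f, hf, ⟨rfl, rfl⟩ | ⟨rfl, rfl⟩⟩)
    · exact Bal.refl u
    · exact hb.map f
    · exact hb.symm.map f
  level := by
    rintro u v (rfl | ⟨f, hf, h⟩)
    · exact Or.inl rfl
    · right
      have hu : Bal (FreeSemigroup.map f a) u := by
        rcases h with ⟨rfl, -⟩ | ⟨rfl, -⟩
        · exact Bal.refl _
        · exact hb.map f
      rw [← hu.length_eq, ← hu.content_eq, length_map, content_card_map hf]
      simp

/-- Apply `rel_or_rel` with the relations generated by the pairs `(a, c)` and `(b, c)`. If `r` did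
not relate `a` to `c`, it would meet the first trivially, while the second does not relate `a` to
`b`. -/
theorem IsSemidistributive.rel_of_not_renames {r : Setoid Word} (hd : IsSemidistributive r)
    (hr : IsFullyInvariant r) (hrb : IsBalanced r) {a b c : Word} (hab : r a b) (hne : a ≠ b)
    (hb : Bal a c) (hac : ¬ Renames a c) (hbc : ¬ Renames b c) : r a c := by
  by_contra hcon
  have hbb : Bal b c := (hrb hab).symm.trans hb
  have hset : {i | i ∈ a.letters} = {i | i ∈ b.letters} := Set.ext fun i => (hrb hab).mem_iff
  have hset' : {i | i ∈ a.letters} = {i | i ∈ c.letters} := Set.ext fun i => hb.mem_iff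
  have hs := pairSetoid_invariant hb hac
  have ht : IsRenamingInvariant a (pairSetoid hbb hbc) := by
    have := pairSetoid_invariant hbb hbc
    refine ⟨this.map, this.bal, ?_⟩
    rw [(hrb hab).length_eq, (hrb hab).content_eq]
    exact this.level
  have hid : ∀ w : Word, FreeSemigroup.map id w = w := fun w => by
    conv_rhs => rw [← map_map_eq_self (u := w) (f := id) (g := id) fun _ _ => rfl]
    rw [map_map]
    rfl
  have hren : ∀ f g : ℕ → ℕ, Set.InjOn f {i | i ∈ a.letters} → Set.InjOn g {i | i ∈ a.letters} →
      ∀ u, Bal a u → ¬ Renames u c → FreeSemigroup.map f u ≠ FreeSemigroup.map g c := by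
    intro f g hf hg u hu hn h
    have hsu : {i | i ∈ a.letters} = {i | i ∈ u.letters} := Set.ext fun i => hu.mem_iff
    have h₁ : Renames u (FreeSemigroup.map f u) := ⟨f, hsu ▸ hf, rfl⟩
    have h₂ : Renames c (FreeSemigroup.map g c) := ⟨g, hset' ▸ hg, rfl⟩
    exact hn (h₁.trans (h ▸ h₂.symm))
  -- In a common pair, equal images of `c` determine the renaming on all letters, which then
  -- identifies `a` with `b`. The crossed cases would make `c` a renaming of `a` or of `b`.
  have hst : ∀ x y, Bal a x → pairSetoid hb hac x y → pairSetoid hbb hbc x y → x = y := by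
    rintro x y - (h | ⟨f, hf, ⟨h₁, h₂⟩ | ⟨h₁, h₂⟩⟩) (h' | ⟨g, hg, ⟨h₃, h₄⟩ | ⟨h₃, h₄⟩⟩)
    any_goals assumption
    all_goals rw [← hset] at hg
    · have e := map_congr (hb.symm.trans (hrb hab)) (h₂.symm.trans h₄)
      exact absurd (map_injOn (hrb hab) hf (h₁.symm.trans (h₃.trans e.symm))) hne
    · exact absurd (h₁.symm.trans h₃) (hren f g hf hg a (Bal.refl a) hac)
    · exact absurd (h₃.symm.trans h₁) (hren g f hg hf b (hrb hab) hbc)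
    · have e := map_congr (hb.symm.trans (hrb hab)) (h₁.symm.trans h₃)
      exact absurd (map_injOn (hrb hab) hf (h₂.symm.trans (h₄.trans e.symm))) hne
  have hrs : ∀ x y, Bal a x → r x y → pairSetoid hb hac x y → x = y := by
    rintro x y - hxy (h | ⟨f, hf, ⟨rfl, rfl⟩ | ⟨rfl, rfl⟩⟩)
    · exact h
    · exact absurd (hr.rel_of_map hb hf hxy) hcon
    · exact absurd (hr.rel_of_map hb hf (r.symm' hxy)) hcon
  rcases hd.rel_or_rel hrb hs ht hab
    (Or.inr ⟨id, Set.injOn_id _, Or.inl ⟨(hid a).symm, (hid c).symm⟩⟩)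
    (Or.inr ⟨id, Set.injOn_id _, Or.inr ⟨(hid c).symm, (hid b).symm⟩⟩) hst hrs with h | h
  · rcases h with h | ⟨f, hf, ⟨-, h⟩ | ⟨h, -⟩⟩
    · exact hne h
    · exact hbc (Renames.symm ⟨f, hset' ▸ (hset ▸ hf), h⟩)
    · exact hac (Renames.symm ⟨f, hset' ▸ (hset ▸ hf), h⟩)
  · exact hcon h

/-! ### Semidistributive congruences are locally trivial or full -/

/-- A nontrivial pair reaches every word outside the orbits of its two members. With three orbits
available, each orbit is avoided by some nontrivial pair related to `a`. -/
theorem IsSemidistributive.full_of_three_orbits {r : Setoid Word} (hd : IsSemidistributive r)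
    (hr : IsFullyInvariant r) (hrb : IsBalanced r) {a b : Word} (hab : r a b) (hne : a ≠ b)
    {p₁ p₂ p₃ : Word} (h₁ : Bal a p₁) (h₂ : Bal a p₂) (h₃ : Bal a p₃) (h₁₂ : ¬ Renames p₁ p₂)
    (h₁₃ : ¬ Renames p₁ p₃) (h₂₃ : ¬ Renames p₂ p₃) (u : Word) (hu : Bal a u) : r a u := by
  have third : ∀ x y, ∃ c, Bal a c ∧ ¬ Renames x c ∧ ¬ Renames y c := by
    intro x y
    by_contra hcon
    push Not at hcon
    have e₁ := hcon _ h₁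
    have e₂ := hcon _ h₂
    have e₃ := hcon _ h₃
    have key : ∀ z p q, ¬ Renames p q → Renames z p → ¬ Renames z q :=
      fun z p q h h' h'' => h (h'.symm.trans h'')
    have x₁₂ := key x _ _ h₁₂
    have x₁₃ := key x _ _ h₁₃
    have x₂₃ := key x _ _ h₂₃
    have y₁₂ := key y _ _ h₁₂
    have y₁₃ := key y _ _ h₁₃
    have y₂₃ := key y _ _ h₂₃
    tauto
  have step : ∀ {x y c}, Bal a x → r x y → x ≠ y → Bal a c → ¬ Renames x c → ¬ Renames y c →
      r x c := fun hx hxy hne hc => hd.rel_of_not_renames hr hrb hxy hne (hx.symm.trans hc)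
  have ne_of : ∀ {x y}, ¬ Renames x y → x ≠ y := by
    rintro x _ h rfl
    exact h (Renames.refl x)
  have hb : Bal a b := hrb hab
  by_cases hO : Renames a b
  · have hrest : ∀ c, Bal a c → ¬ Renames a c → r a c := fun c hc hac =>
      step (Bal.refl a) hab hne hc hac fun h => hac (hO.trans h)
    obtain ⟨c, hc, hac, -⟩ := third a a
    obtain ⟨c', hc', hac', hcc'⟩ := third a c
    by_cases hau : Renames a u
    · have hcc : r c c' := r.trans' (r.symm' (hrest c hc hac)) (hrest c' hc' hac')
      have := step hc hcc (ne_of hcc') hu (fun h => hac (hau.trans h.symm))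
        (fun h => hac' (hau.trans h.symm))
      exact r.trans' (hrest c hc hac) this
    · exact hrest u hu hau
  · obtain ⟨c, hc, hac, hbc⟩ := third a b
    have hrac : r a c := step (Bal.refl a) hab hne hc hac hbc
    by_cases hau : Renames a u
    · have := step hb (r.trans' (r.symm' hab) hrac) (ne_of hbc) hu
        (fun h => hO (hau.trans h.symm)) (fun h => hac (hau.trans h.symm))
      exact r.trans' hab this
    · by_cases hbu : Renames b u
      · exact step (Bal.refl a) hrac (ne_of hac) hu hau fun h => hbc (hbu.trans h.symm)
      · exact step (Bal.refl a) hab hne hu hau hbu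

theorem Word.exists_ne_of_bal_of_ne {a b : Word} (h : Bal a b) (hne : a ≠ b) (x : ℕ) :
    ∃ y ∈ a.letters, y ≠ x := by
  by_contra hcon
  push Not at hcon
  refine hne (letters_injective ?_)
  rw [List.eq_replicate_of_mem hcon, List.eq_replicate_of_mem fun y hy => hcon y (h.mem_iff.2 hy),
    length_letters, length_letters, h.length_eq]

/-- A repeated letter `x` and another letter `y` allow the beginnings `xxy`, `xyx`, `yxx`. Renaming
preserves which positions carry equal letters, so these lie in three different orbits. -/
theorem IsSemidistributive.full_of_not_nodup {r : Setoid Word} (hd : IsSemidistributive r)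
    (hr : IsFullyInvariant r) (hrb : IsBalanced r) {a b : Word} (hab : r a b) (hne : a ≠ b)
    (hnd : ¬ a.letters.Nodup) (u : Word) (hu : Bal a u) : r a u := by
  obtain ⟨x, hx⟩ : ∃ x, List.Duplicate x a.letters := List.exists_duplicate_iff_not_nodup.2 hnd
  obtain ⟨y, hy, hyx⟩ := exists_ne_of_bal_of_ne (hrb hab) hne x
  have hxx : List.Sublist [x, x] a.letters := List.duplicate_iff_sublist.1 hx
  obtain ⟨l, hl⟩ : ∃ l, a.letters.Perm (x :: x :: y :: l) := by
    obtain ⟨l₁, h₁⟩ := hxx.exists_perm_append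
    have : y ∈ l₁ := by
      have := h₁.mem_iff.1 hy
      simpa [hyx] using this
    exact ⟨l₁.erase y, h₁.trans (List.Perm.append_left [x, x] (List.perm_cons_erase this))⟩
  obtain ⟨p₁, h₁⟩ := exists_letters_eq (l := x :: x :: y :: l) (by simp)
  obtain ⟨p₂, h₂⟩ := exists_letters_eq (l := x :: y :: x :: l) (by simp)
  obtain ⟨p₃, h₃⟩ := exists_letters_eq (l := y :: x :: x :: l) (by simp)
  have e₂ : (x :: x :: y :: l).Perm (x :: y :: x :: l) := List.Perm.cons _ (List.Perm.swap _ _ _)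
  refine hd.full_of_three_orbits hr hrb hab hne (p₁ := p₁) (p₂ := p₂) (p₃ := p₃)
    (by rwa [Bal, h₁]) (by rw [Bal, h₂]; exact hl.trans e₂)
    (by rw [Bal, h₃]; exact hl.trans (e₂.trans (List.Perm.swap _ _ _))) ?_ ?_ ?_ u hu
  · rintro ⟨f, -, h⟩
    have := congrArg letters h
    rw [letters_map, h₁, h₂] at this
    simp only [List.map_cons, List.cons.injEq] at this
    exact hyx (this.2.1.trans this.1.symm)
  · rintro ⟨f, -, h⟩
    have := congrArg letters h
    rw [letters_map, h₁, h₃] at this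
    simp only [List.map_cons, List.cons.injEq] at this
    exact hyx (this.1.trans this.2.1.symm)
  · rintro ⟨f, -, h⟩
    have := congrArg letters h
    rw [letters_map, h₂, h₃] at this
    simp only [List.map_cons, List.cons.injEq] at this
    exact hyx (this.1.trans this.2.2.1.symm)

/-! ### Words without repeated letters -/

namespace Word

/-- The permutation moves only letters of `a`. -/
def Supports (a : Word) (p : Equiv.Perm ℕ) : Prop := ∀ i, i ∉ a.letters → p i = i

theorem Supports.mul {a : Word} {p q : Equiv.Perm ℕ} (hp : Supports a p) (hq : Supports a q) :
    Supports a (p * q) := fun i hi => by rw [Equiv.Perm.mul_apply, hq i hi, hp i hi]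

theorem Supports.zpow {a : Word} {p : Equiv.Perm ℕ} (hp : Supports a p) (n : ℤ) :
    Supports a (p ^ n) := fun i hi => Equiv.Perm.zpow_apply_eq_self_of_apply_eq_self (hp i hi) n

theorem supports_swap {a : Word} {x y : ℕ} (hx : x ∈ a.letters) (hy : y ∈ a.letters) :
    Supports a (Equiv.swap x y) := fun _ hi =>
  Equiv.swap_apply_of_ne_of_ne (fun h => hi (h ▸ hx)) (fun h => hi (h ▸ hy))

theorem Supports.mem_iff {a : Word} {p : Equiv.Perm ℕ} (hp : Supports a p) {i : ℕ} :
    p i ∈ a.letters ↔ i ∈ a.letters := by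
  constructor
  · intro h
    by_contra hi
    exact hi (hp i hi ▸ h)
  · intro h
    by_contra hi
    rw [p.injective (hp _ hi)] at hi
    exact hi h

theorem Supports.eq_of_map_eq {a : Word} {p q : Equiv.Perm ℕ} (hp : Supports a p)
    (hq : Supports a q) (h : FreeSemigroup.map p a = FreeSemigroup.map q a) : p = q := by
  ext i
  by_cases hi : i ∈ a.letters
  · exact map_eq_map_iff.1 h i hi
  · rw [hp i hi, hq i hi]

theorem Supports.bal {a : Word} {p : Equiv.Perm ℕ} (hp : Supports a p) (ha : a.letters.Nodup) :
    Bal a (FreeSemigroup.map p a) := by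
  rw [Bal, letters_map, List.perm_ext_iff_of_nodup ha (ha.map p.injective)]
  intro i
  constructor
  · intro hi
    refine List.mem_map.2 ⟨p.symm i, ?_, by simp⟩
    rw [← hp.mem_iff]
    simpa using hi
  · intro hi
    obtain ⟨j, hj, rfl⟩ := List.mem_map.1 hi
    exact hp.mem_iff.2 hj

/-- Send the letter of `a` at each position to the letter of `b` there, and fix all other letters.
-/
theorem exists_supports_of_bal {a b : Word} (ha : a.letters.Nodup) (h : Bal a b) :
    ∃ p : Equiv.Perm ℕ, Supports a p ∧ b = FreeSemigroup.map p a := by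
  have hb : b.letters.Nodup := (List.Perm.nodup_iff h).1 ha
  let e : {i // i ∈ a.letters} ≃ {i // i ∈ a.letters} :=
    (ha.getEquiv.symm.trans (finCongr (List.Perm.length_eq h))).trans
      (hb.getEquiv.trans (Equiv.subtypeEquivRight fun i => (h.mem_iff (i := i)).symm))
  refine ⟨Equiv.Perm.ofSubtype e, fun i hi => Equiv.Perm.ofSubtype_apply_of_not_mem e hi, ?_⟩
  apply letters_injective
  rw [letters_map]
  apply List.ext_getElem
  · rw [List.length_map, List.Perm.length_eq h]
  · intro i h₁ h₂
    rw [List.getElem_map]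
    have h₃ : i < a.letters.length := by simpa using h₂
    rw [Equiv.Perm.ofSubtype_apply_of_mem e (List.getElem_mem h₃)]
    simp [e, List.Nodup.getEquiv, List.Nodup.idxOf_getElem ha]

end Word

/-- The renaming invariant relation whose class of `a` consists of the images of `a` under the
powers of `p`. -/
def zpowersSetoid {a : Word} {p : Equiv.Perm ℕ} (hp : Supports a p) : Setoid Word where
  r u v := u = v ∨ ∃ f : ℕ → ℕ, Set.InjOn f {i | i ∈ a.letters} ∧ ∃ n : ℤ,
    u = FreeSemigroup.map f a ∧ v = FreeSemigroup.map (f ∘ (p ^ n : Equiv.Perm ℕ)) a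
  iseqv := by
    have hcomp : ∀ {f : ℕ → ℕ} (n : ℤ), Set.InjOn f {i | i ∈ a.letters} →
        Set.InjOn (f ∘ (p ^ n : Equiv.Perm ℕ)) {i | i ∈ a.letters} := fun n hf =>
      hf.comp (Equiv.injective _).injOn fun i hi => (hp.zpow n).mem_iff.2 hi
    refine ⟨fun _ => Or.inl rfl, ?_, ?_⟩
    · rintro u v (h | ⟨f, hf, n, rfl, rfl⟩)
      · exact Or.inl h.symm
      · refine Or.inr ⟨_, hcomp n hf, -n, rfl, ?_⟩
        rw [map_eq_map_iff]
        intro i _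
        simp only [Function.comp_apply, ← Equiv.Perm.mul_apply, ← zpow_add]
        simp
    · rintro u v w (rfl | ⟨f, hf, n, rfl, rfl⟩) (rfl | ⟨g, hg, m, h, rfl⟩)
      · exact Or.inl rfl
      · exact Or.inr ⟨g, hg, m, h, rfl⟩
      · exact Or.inr ⟨f, hf, n, rfl, rfl⟩
      · refine Or.inr ⟨f, hf, n + m, rfl, ?_⟩
        rw [map_eq_map_iff] at h ⊢
        intro i hi
        have := h _ ((hp.zpow m).mem_iff.2 hi)
        rw [Function.comp_apply, ← this]
        simp [zpow_add]

theorem zpowersSetoid_invariant {a : Word} (ha : a.letters.Nodup) {p : Equiv.Perm ℕ}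
    (hp : Supports a p) : IsRenamingInvariant a (zpowersSetoid hp) where
  map := by
    rintro g u v hg (rfl | ⟨f, hf, n, rfl, rfl⟩)
    · exact Or.inl rfl
    · refine Or.inr ⟨g ∘ f, hg.comp hf fun i hi => ?_, n, map_map _ _ _, map_map _ _ _⟩
      rw [Set.mem_ofPred_eq, letters_map]
      exact List.mem_map_of_mem hi
  bal := by
    rintro u v (rfl | ⟨f, hf, n, rfl, rfl⟩)
    · exact Bal.refl _
    · rw [← map_map]
      exact ((hp.zpow n).bal ha).map f
  level := by
    rintro u v (rfl | ⟨f, hf, n, rfl, rfl⟩)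
    · exact Or.inl rfl
    · exact Or.inr ⟨length_map _ _, content_card_map hf⟩

/-- Test with the powers of `t` and of `t * h`; the triangle closes because `t * (t * h) = h`. A
nontrivial overlap makes `t` a power of `t * h`, and the first outcome of the test makes `h` such a
power. Either way `t` and `h` commute. -/
theorem IsSemidistributive.commute_of_not_rel {r : Setoid Word} (hd : IsSemidistributive r)
    (hr : IsFullyInvariant r) (hrb : IsBalanced r) {a : Word} (ha : a.letters.Nodup)
    {h t : Equiv.Perm ℕ} (hh : Supports a h) (ht : Supports a t) (htt : t * t = 1)
    (hrh : r a (FreeSemigroup.map h a)) (hrt : ¬ r a (FreeSemigroup.map t a)) : Commute t h := by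
  by_contra hcomm
  have hid : FreeSemigroup.map id a = a := by
    apply letters_injective
    rw [letters_map, List.map_id]
  have hth := ht.mul hh
  have ht2 : ∀ n : ℤ, t ^ n = 1 ∨ t ^ n = t := by
    intro n
    have h2 : t ^ (2 : ℤ) = 1 := by rw [zpow_two, htt]
    rcases Int.even_or_odd' n with ⟨k, rfl | rfl⟩
    · left
      rw [zpow_mul, h2, one_zpow]
    · right
      rw [zpow_add, zpow_mul, h2, one_zpow, one_mul, zpow_one]
  have hcb : FreeSemigroup.map h a =
      FreeSemigroup.map (t ∘ ((t * h) ^ (1 : ℤ) : Equiv.Perm ℕ)) a := by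
    rw [map_eq_map_iff]
    intro i _
    rw [zpow_one, Function.comp_apply, ← Equiv.Perm.mul_apply, ← mul_assoc, htt, one_mul]
  have hst : ∀ x y, Bal a x → zpowersSetoid ht x y → zpowersSetoid hth x y → x = y := by
    rintro x y - (h₁ | ⟨f, hf, n, rfl, rfl⟩) (h₂ | ⟨g, hg, m, h₃, h₄⟩)
    any_goals assumption
    rcases ht2 n with hn | hn
    · rw [hn]
      rfl
    · exfalso
      rw [hn, ← map_map] at h₄
      rw [map_eq_map_iff] at h₃
      have h₅ : FreeSemigroup.map (g ∘ ((t * h) ^ m : Equiv.Perm ℕ)) a =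
          FreeSemigroup.map f (FreeSemigroup.map ((t * h) ^ m : Equiv.Perm ℕ) a) := by
        rw [map_map, map_eq_map_iff]
        intro i hi
        exact (h₃ _ ((hth.zpow m).mem_iff.2 hi)).symm
      rw [h₅] at h₄
      have hbt := ht.bal ha
      have h₆ := map_injOn (hbt.symm.trans ((hth.zpow m).bal ha)) (fun i hi j hj => hf
        (hbt.mem_iff.2 hi) (hbt.mem_iff.2 hj)) h₄
      have h₇ : t = (t * h) ^ m := ht.eq_of_map_eq (hth.zpow m) h₆
      have : Commute (t * h) t := by
        conv_rhs => rw [h₇]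
        exact Commute.self_zpow _ _
      apply hcomm
      have h1 : t * (h * t) = t * (t * h) := by rw [← mul_assoc, this.eq]
      exact (mul_left_cancel h1).symm
  have hrs : ∀ x y, Bal a x → r x y → zpowersSetoid ht x y → x = y := by
    rintro x y - hxy (h₁ | ⟨f, hf, n, rfl, rfl⟩)
    · exact h₁
    rcases ht2 n with hn | hn
    · rw [hn]
      rfl
    · rw [hn, ← map_map] at hxy
      exact absurd (hr.rel_of_map (ht.bal ha) hf hxy) hrt
  rcases hd.rel_or_rel hrb (zpowersSetoid_invariant ha ht) (zpowersSetoid_invariant ha hth) hrh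
    (c := FreeSemigroup.map t a)
    (Or.inr ⟨id, Set.injOn_id _, 1, hid.symm, by simp⟩)
    (Or.inr ⟨t, t.injective.injOn, 1, rfl, hcb⟩) hst hrs with h' | h'
  · have hpow : ∃ n : ℤ, h = (t * h) ^ n := by
      rcases h' with h' | ⟨f, hf, n, h₁, h₂⟩
      · refine ⟨0, hh.eq_of_map_eq (hth.zpow 0) ?_⟩
        rw [← h']
        simpa using hid.symm
      · refine ⟨n, hh.eq_of_map_eq (hth.zpow n) (h₂.trans ?_)⟩
        rw [map_eq_map_iff]
        intro i hi
        have h₁' : FreeSemigroup.map id a = FreeSemigroup.map f a := hid.trans h₁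
        rw [map_eq_map_iff] at h₁'
        exact (h₁' _ ((hth.zpow n).mem_iff.2 hi)).symm
    obtain ⟨n, hn⟩ := hpow
    have : Commute (t * h) h := by
      conv_rhs => rw [hn]
      exact Commute.self_zpow _ _
    apply hcomm
    have h1 : t * h * h = h * t * h := by rw [this.eq, mul_assoc]
    exact mul_right_cancel h1
  · exact hrt h'

/-- The permutations carrying `a` to a related word are closed under products, so it suffices to
find all transpositions of letters of `a` among them. -/
theorem IsSemidistributive.full_of_nodup {r : Setoid Word} (hd : IsSemidistributive r)
    (hr : IsFullyInvariant r) (hrb : IsBalanced r) {a b : Word} (hab : r a b) (hne : a ≠ b)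
    (ha : a.letters.Nodup) (u : Word) (hu : Bal a u) : r a u := by
  obtain ⟨h, hh, rfl⟩ := exists_supports_of_bal ha (hrb hab)
  obtain ⟨x, hx, hxh⟩ : ∃ x ∈ a.letters, h x ≠ x := by
    by_contra hcon
    push Not at hcon
    apply hne
    apply letters_injective
    rw [letters_map]
    conv_lhs => rw [← List.map_id a.letters]
    exact List.map_congr_left fun i hi => (hcon i hi).symm
  have hy : h x ∈ a.letters := hh.mem_iff.2 hx
  have hmul : ∀ p q : Equiv.Perm ℕ, r a (FreeSemigroup.map p a) → r a (FreeSemigroup.map q a) →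
      r a (FreeSemigroup.map (p * q) a) := by
    intro p q hp hq
    refine r.trans' hp ?_
    have := hr.map p hq
    rwa [map_map] at this
  -- If `g` moves `w` outside `{w, w'}`, it cannot commute with the swap: evaluating both products
  -- at `w` would give `g w = g w'`.
  have hcomm : ∀ w w', w ∈ a.letters → w' ∈ a.letters → w ≠ w' → ∀ g, Supports a g →
      r a (FreeSemigroup.map g a) → g w ≠ w → g w ≠ w' →
      r a (FreeSemigroup.map (Equiv.swap w w') a) := by
    intro w w' hw hw' hne' g hg hrg h₁ h₂
    by_contra hcon
    have hc := hd.commute_of_not_rel hr hrb ha hg (supports_swap hw hw')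
      (Equiv.swap_mul_self w w') hrg hcon
    have e := Equiv.congr_fun hc.eq w
    simp only [Equiv.Perm.mul_apply, Equiv.swap_apply_left] at e
    rw [Equiv.swap_apply_of_ne_of_ne h₁ h₂] at e
    exact hne' (g.injective e)
  have hother : ∀ z ∈ a.letters, z ≠ x → z ≠ h x → r a (FreeSemigroup.map (Equiv.swap x z) a) :=
    fun z hz hzx hzy => hcomm x z hx hz hzx.symm h hh hab hxh hzy.symm
  have hxy : r a (FreeSemigroup.map (Equiv.swap x (h x)) a) := by
    -- With a third letter `z`, the swap of `x` and `z` plays the role of `g`. With only two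
    -- letters, `h` itself acts as the swap.
    by_cases hz : ∃ z ∈ a.letters, z ≠ x ∧ z ≠ h x
    · obtain ⟨z, hz, hzx, hzy⟩ := hz
      refine hcomm x (h x) hx hy hxh.symm _ (supports_swap hx hz) (hother z hz hzx hzy) ?_ ?_
      · rwa [Equiv.swap_apply_left]
      · rwa [Equiv.swap_apply_left]
    · push Not at hz
      have : FreeSemigroup.map (Equiv.swap x (h x)) a = FreeSemigroup.map h a := by
        rw [map_eq_map_iff]
        intro i hi
        by_cases hix : i = x
        · rw [hix, Equiv.swap_apply_left]
        · have hix' := hz i hi hix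
          rw [hix', Equiv.swap_apply_right]
          by_contra hc
          have := hz _ (hh.mem_iff.2 hy) (Ne.symm hc)
          exact hxh (h.injective this)
      rw [this]
      exact hab
  have hsx : ∀ z ∈ a.letters, r a (FreeSemigroup.map (Equiv.swap x z) a) := by
    intro z hz
    by_cases h₁ : z = x
    · subst h₁
      rw [Equiv.swap_self]
      have : FreeSemigroup.map (Equiv.refl ℕ) a = a := by
        apply letters_injective
        rw [letters_map, Equiv.coe_refl, List.map_id]
      rw [this]
    · by_cases h₂ : z = h x
      · rwa [h₂]
      · exact hother z hz h₁ h₂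
  have hswap : ∀ y z, y ∈ a.letters → z ∈ a.letters →
      r a (FreeSemigroup.map (Equiv.swap y z) a) := by
    intro y z hy hz
    by_cases h₁ : y = x
    · rw [h₁]
      exact hsx z hz
    by_cases h₂ : z = x
    · rw [h₂, Equiv.swap_comm]
      exact hsx y hy
    by_cases h₃ : y = z
    · rw [h₃, Equiv.swap_self, ← Equiv.swap_self x]
      exact hsx x hx
    · have : Equiv.swap y z = Equiv.swap x y * Equiv.swap x z * Equiv.swap x y := by
        rw [Equiv.swap_comm x z, Equiv.swap_mul_swap_mul_swap h₂ (Ne.symm h₃)]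
      rw [this]
      exact hmul _ _ (hmul _ _ (hsx y hy) (hsx z hz)) (hsx y hy)
  obtain ⟨p, hp, rfl⟩ := exists_supports_of_bal ha hu
  have hp' : p = Equiv.Perm.ofSubtype
      (p.subtypePerm (p := fun i => i ∈ a.letters) fun i => hp.mem_iff) := by
    refine (Equiv.Perm.ofSubtype_subtypePerm _ fun i hi => ?_).symm
    by_contra hc
    exact hi (hp i hc)
  rw [hp']
  generalize p.subtypePerm (p := fun i => i ∈ a.letters) _ = σ
  induction σ using Equiv.Perm.swap_induction_on with
  | one =>
    -- The identity is written as the square of the degenerate swap of `x` with itself, so that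
    -- `hmul` applies.
    rw [map_one, ← Equiv.swap_mul_self x x]
    exact hmul _ _ (hsx x hx) (hsx x hx)
  | swap_mul f y z _ ih =>
    rw [map_mul, Equiv.Perm.ofSubtype_swap_eq]
    exact hmul _ _ (hswap y z y.2 z.2) ih

theorem IsSemidistributive.isLocallyTrivialOrFull {r : Setoid Word} (hd : IsSemidistributive r)
    (hr : IsFullyInvariant r) (hrb : IsBalanced r) : IsLocallyTrivialOrFull r := by
  intro a b hab hne u hu
  by_cases ha : a.letters.Nodup
  · exact hd.full_of_nodup hr hrb hab hne ha u hu
  · exact hd.full_of_not_nodup hr hrb hab hne ha u hu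

/-! ### Multisets with prescribed multiplicities -/

/-- The multiset of multiplicities of the elements of `M`. -/
def multiplicities (M : Multiset ℕ) : Multiset ℕ := M.dedup.map fun i => M.count i

/-- The multiset in which the members of `L` have the multiplicities listed in `ps`. -/
def expand (ps L : List ℕ) : Multiset ℕ := (List.zipWith Multiset.replicate ps L).sum

@[simp] theorem expand_nil (L : List ℕ) : expand [] L = 0 := by simp [expand]

@[simp] theorem expand_cons (p x : ℕ) (ps L : List ℕ) :
    expand (p :: ps) (x :: L) = Multiset.replicate p x + expand ps L := by
  simp [expand]

theorem expand_map (f : ℕ → ℕ) (ps L : List ℕ) :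
    (expand ps L).map f = expand ps (L.map f) := by
  induction ps generalizing L with
  | nil => simp
  | cons p ps ih =>
    cases L with
    | nil => simp [expand]
    | cons x L => simp [ih]

theorem expand_append {ps L : List ℕ} (h : ps.length = L.length) (qs M : List ℕ) :
    expand (ps ++ qs) (L ++ M) = expand ps L + expand qs M := by
  induction ps generalizing L with
  | nil =>
    obtain rfl := List.eq_nil_of_length_eq_zero h.symm
    simp
  | cons p ps ih =>
    cases L with
    | nil => simp at h
    | cons x L => simp [ih (Nat.succ.inj h), add_assoc]

theorem expand_replicate_one (L : List ℕ) :
    expand (List.replicate L.length 1) L = (L : Multiset ℕ) := by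
  induction L with
  | nil => simp
  | cons x L ih =>
    rw [List.length_cons, List.replicate_succ, expand_cons, ih]
    rfl

theorem card_expand {ps L : List ℕ} (h : ps.length = L.length) :
    (expand ps L).card = ps.sum := by
  induction ps generalizing L with
  | nil => simp
  | cons p ps ih =>
    cases L with
    | nil => simp at h
    | cons x L => simp [ih (Nat.succ.inj h)]

theorem mem_of_mem_expand {ps L : List ℕ} {x : ℕ} (h : x ∈ expand ps L) : x ∈ L := by
  induction ps generalizing L with
  | nil => simp at h
  | cons p ps ih =>
    cases L with
    | nil => simp [expand] at h
    | cons y L =>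
      rw [expand_cons, Multiset.mem_add] at h
      rcases h with h | h
      · rw [Multiset.eq_of_mem_replicate h]
        exact List.mem_cons_self
      · exact List.mem_cons_of_mem _ (ih h)

theorem mem_expand {ps L : List ℕ} (h : ps.length = L.length) (hpos : ∀ p ∈ ps, 0 < p) {x : ℕ} :
    x ∈ expand ps L ↔ x ∈ L := by
  refine ⟨mem_of_mem_expand, fun hx => ?_⟩
  induction ps generalizing L with
  | nil =>
    obtain rfl := List.eq_nil_of_length_eq_zero h.symm
    simp at hx
  | cons p ps ih =>
    cases L with
    | nil => simp at h
    | cons y L =>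
      rw [expand_cons, Multiset.mem_add]
      rcases List.mem_cons.1 hx with rfl | hx
      · left
        exact Multiset.mem_replicate.2 ⟨(hpos p List.mem_cons_self).ne', rfl⟩
      · exact Or.inr (ih (Nat.succ.inj h) (fun q hq => hpos q (List.mem_cons_of_mem _ hq)) hx)

theorem map_count_expand {ps L : List ℕ} (h : ps.length = L.length) (hL : L.Nodup) :
    L.map (fun i => (expand ps L).count i) = ps := by
  induction ps generalizing L with
  | nil =>
    obtain rfl := List.eq_nil_of_length_eq_zero h.symm
    simp
  | cons p ps ih =>
    cases L with
    | nil => simp at h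
    | cons y L =>
      rw [List.nodup_cons] at hL
      rw [List.map_cons, expand_cons, Multiset.count_add, Multiset.count_replicate_self,
        Multiset.count_eq_zero_of_notMem fun hy => hL.1 (mem_of_mem_expand hy), add_zero]
      congr 1
      conv_rhs => rw [← ih (Nat.succ.inj h) hL.2]
      refine List.map_congr_left fun i hi => ?_
      rw [Multiset.count_add, Multiset.count_replicate, if_neg, zero_add]
      rintro rfl
      exact hL.1 hi

theorem dedup_expand {ps L : List ℕ} (h : ps.length = L.length) (hL : L.Nodup)
    (hpos : ∀ p ∈ ps, 0 < p) : (expand ps L).dedup = L := by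
  rw [Multiset.Nodup.ext (Multiset.nodup_dedup _) (Multiset.coe_nodup.2 hL)]
  intro x
  rw [Multiset.mem_dedup, mem_expand h hpos, Multiset.mem_coe]

theorem multiplicities_expand {ps L : List ℕ} (h : ps.length = L.length) (hL : L.Nodup)
    (hpos : ∀ p ∈ ps, 0 < p) : multiplicities (expand ps L) = ps := by
  rw [multiplicities, dedup_expand h hL hpos, Multiset.map_coe, map_count_expand h hL]

theorem expand_map_count {M : Multiset ℕ} {L : List ℕ} (hL : (L : Multiset ℕ) = M.dedup) :
    expand (L.map fun i => M.count i) L = M := by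
  have hnd : L.Nodup := by
    rw [← Multiset.coe_nodup, hL]
    exact Multiset.nodup_dedup _
  have hmem : ∀ i, i ∈ L ↔ i ∈ M := fun i => by
    rw [← Multiset.mem_coe, hL, Multiset.mem_dedup]
  ext i
  by_cases hi : i ∈ L
  · have := map_count_expand (ps := L.map fun i => M.count i) (by simp) hnd
    exact List.map_inj_left.1 this i hi
  · rw [Multiset.count_eq_zero_of_notMem fun h => hi (mem_of_mem_expand h),
      Multiset.count_eq_zero_of_notMem fun h => hi ((hmem i).2 h)]

theorem exists_expand_eq {M : Multiset ℕ} {ps : List ℕ} (h : multiplicities M = ps) :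
    ∃ L : List ℕ, L.Nodup ∧ ps.length = L.length ∧ expand ps L = M ∧
      ps = L.map fun i => M.count i := by
  have hp : ps.Perm (M.dedup.toList.map fun i => M.count i) := by
    rw [← Multiset.coe_eq_coe, ← h, multiplicities, ← Multiset.map_coe, Multiset.coe_toList]
  have := congrFun (congrFun (List.eq_map_comp_perm (fun i => M.count i)) ps) M.dedup.toList
  rw [eq_iff_iff] at this
  obtain ⟨L, rfl, hL⟩ := this.2 hp
  have hL' : (L : Multiset ℕ) = M.dedup := by
    rw [Multiset.coe_eq_coe.2 hL, Multiset.coe_toList]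
  refine ⟨L, ?_, by simp, expand_map_count hL', rfl⟩
  rw [← Multiset.coe_nodup, hL']
  exact Multiset.nodup_dedup _

theorem multiplicities_cons {x : ℕ} {M : Multiset ℕ} (h : x ∉ M) :
    multiplicities (x ::ₘ M) = 1 ::ₘ multiplicities M := by
  rw [multiplicities, Multiset.dedup_cons_of_notMem h, Multiset.map_cons, Multiset.count_cons_self,
    Multiset.count_eq_zero_of_notMem h, multiplicities]
  congr 1
  refine Multiset.map_congr rfl fun i hi => ?_
  rw [Multiset.count_cons_of_ne]
  rintro rfl
  exact h (Multiset.mem_dedup.1 hi)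

theorem sum_multiplicities (M : Multiset ℕ) : (multiplicities M).sum = M.card := by
  obtain ⟨L, -, h, h', -⟩ := exists_expand_eq (M := M) (ps := (multiplicities M).toList) (by simp)
  conv_rhs => rw [← h', card_expand h]
  rw [← Multiset.sum_coe, Multiset.coe_toList]

theorem pos_of_mem_multiplicities {M : Multiset ℕ} {p : ℕ} (h : p ∈ multiplicities M) :
    0 < p := by
  obtain ⟨i, hi, rfl⟩ := Multiset.mem_map.1 h
  exact Multiset.count_pos.2 (Multiset.mem_dedup.1 hi)

theorem filter_count_eq_one (M : Multiset ℕ) :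
    M.filter (fun i => M.count i = 1) = M.dedup.filter fun i => M.count i = 1 := by
  ext i
  rw [Multiset.count_filter, Multiset.count_filter]
  split_ifs with h
  · rw [h, Multiset.count_dedup, if_pos]
    exact Multiset.one_le_count_iff_mem.1 h.ge
  · rfl

theorem countP_count_eq_one (M : Multiset ℕ) :
    M.countP (fun i => M.count i = 1) = (multiplicities M).count 1 := by
  rw [Multiset.countP_eq_card_filter, filter_count_eq_one, multiplicities, Multiset.count_map]
  simp only [eq_comm]

theorem count_one_add_sum_filter {P : Multiset ℕ} (hpos : ∀ p ∈ P, 0 < p) :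
    P.count 1 + (P.filter fun p => 1 < p).sum = P.sum := by
  induction P using Multiset.induction_on with
  | empty => simp
  | cons p P ih =>
    have ih' := ih fun q hq => hpos q (Multiset.mem_cons_of_mem hq)
    have hp := hpos p (Multiset.mem_cons_self p P)
    rw [Multiset.sum_cons]
    by_cases h : 1 < p
    · rw [Multiset.filter_cons_of_pos (p := fun p => 1 < p) _ h,
        Multiset.count_cons_of_ne (by omega), Multiset.sum_cons]
      omega
    · obtain rfl : p = 1 := by omega
      rw [Multiset.filter_cons_of_neg (p := fun p => 1 < p) _ h, Multiset.count_cons_self]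
      omega

/-- Occurrences are counted here, not letters: each repeated letter contributes its whole
multiplicity. -/
theorem countP_count_ne_one (M : Multiset ℕ) :
    M.countP (fun i => ¬ M.count i = 1) = ((multiplicities M).filter fun p => 1 < p).sum := by
  have h₁ := M.card_eq_countP_add_countP fun i => M.count i = 1
  have h₂ := count_one_add_sum_filter (P := multiplicities M) fun p => pos_of_mem_multiplicities
  rw [sum_multiplicities, h₁, countP_count_eq_one] at h₂
  omega

/-! ### Transversals -/

theorem Word.part_eq_iff {u : Word} {l : Ptn} :
    u.part = l.parts ↔ multiplicities u.letters = l.parts := by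
  have h : u.content.val.map u.occ = multiplicities u.letters := by
    rw [multiplicities, content, List.toFinset_val, Multiset.coe_dedup]
    refine Multiset.map_congr rfl fun i _ => ?_
    rw [occ, Multiset.coe_count]
  rw [part, h]
  constructor
  · intro e
    rw [← e, Multiset.sort_eq]
  · intro e
    refine List.Perm.eq_of_pairwise (le := fun a b => a ≥ b) ?_ (Multiset.pairwise_sort _ _)
      l.sorted ?_
    · intro a b _ _ h₁ h₂
      exact le_antisymm h₂ h₁
    · rw [← Multiset.coe_eq_coe, Multiset.sort_eq, e]

/-- The multiplicities of the letters in their natural order and the parts are sorted lists with the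
same members, hence equal. So the transversal is a single balance class. -/
theorem Ptn.mem_transversal_iff {l : Ptn} {w : Word} :
    w ∈ l.transversal ↔ (w.letters : Multiset ℕ) = expand l.parts (List.range l.m) := by
  have hlen : l.parts.length = (List.range l.m).length := by simp [Ptn.m]
  constructor
  · rintro ⟨-, hc, ho, hp⟩
    rw [part_eq_iff] at hp
    have hd : ((List.range l.m : List ℕ) : Multiset ℕ) = (w.letters : Multiset ℕ).dedup := by
      have := congrArg Finset.val hc
      rw [content, List.toFinset_val, ← Multiset.coe_dedup] at this
      rw [this]
      rfl
    have hanti : ∀ j, j < l.m → ∀ i, i ≤ j → occ w j ≤ occ w i := by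
      intro j
      induction j with
      | zero =>
        intro _ i hi
        rw [Nat.le_zero.1 hi]
      | succ j ih =>
        intro hj i hi
        rcases Nat.of_le_succ hi with hi | rfl
        · exact (ho j hj).trans (ih (Nat.lt_of_succ_lt hj) i hi)
        · exact le_rfl
    have hs : ((List.range l.m).map fun i => (w.letters : Multiset ℕ).count i).Pairwise
        (fun a b => a ≥ b) := by
      rw [List.pairwise_iff_getElem]
      intro i j hi hj hij
      rw [List.length_map, List.length_range] at hi hj
      simpa [occ] using hanti j hj i hij.le
    have heq : ((List.range l.m).map fun i => (w.letters : Multiset ℕ).count i) = l.parts := by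
      refine List.Perm.eq_of_pairwise (le := fun a b => a ≥ b)
        (fun a b _ _ h₁ h₂ => le_antisymm h₂ h₁) hs l.sorted ?_
      rw [← Multiset.coe_eq_coe, ← hp, multiplicities, ← Multiset.map_coe, hd]
    rw [← heq]
    exact (expand_map_count hd).symm
  · intro h
    have hocc : (List.range l.m).map w.occ = l.parts := by
      conv_rhs => rw [← map_count_expand hlen List.nodup_range]
      refine List.map_congr_left fun i _ => ?_
      rw [← h, Multiset.coe_count, occ]
    refine ⟨?_, ?_, ?_, ?_⟩
    · rw [← length_letters, ← Multiset.coe_card, h, card_expand hlen, Ptn.n]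
    · ext i
      rw [mem_content, ← Multiset.mem_coe, h, mem_expand hlen l.pos, List.mem_range,
        Finset.mem_range]
    · intro i hi
      have hget : ∀ j (hj : j < l.parts.length), occ w j = l.parts[j] := by
        intro j hj
        simp [← hocc]
      rw [hget i (by have : l.m = l.parts.length := rfl
                     omega), hget (i + 1) hi]
      exact List.pairwise_iff_getElem.1 l.sorted i (i + 1) _ _ (Nat.lt_succ_self i)
    · rw [part_eq_iff, h, multiplicities_expand hlen List.nodup_range l.pos]

theorem Ptn.bal_of_mem_transversal {l : Ptn} {u v : Word} (hu : u ∈ l.transversal)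
    (hv : v ∈ l.transversal) : Bal u v := by
  rw [mem_transversal_iff] at hu hv
  exact Multiset.coe_eq_coe.1 (hu.trans hv.symm)

theorem Ptn.exists_rename_mem_transversal {l : Ptn} {u : Word}
    (h : multiplicities u.letters = l.parts) : ∃ f g : ℕ → ℕ, (∀ i ∈ u.letters, g (f i) = i) ∧
      ∀ v, Bal u v → FreeSemigroup.map f v ∈ l.transversal := by
  obtain ⟨L, hL, hlen, he, -⟩ := exists_expand_eq h
  -- `L` lists the letters of `u` in the order of the parts. The default `0` is never reached at
  -- positions of letters of `u`.
  refine ⟨fun i => L.idxOf i, fun i => L.getD i 0, fun i hi => ?_, fun v hv => ?_⟩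
  · rw [← Multiset.mem_coe, ← he] at hi
    have := List.idxOf_lt_length_of_mem (mem_of_mem_expand hi)
    simp [this]
  · rw [mem_transversal_iff, letters_map, ← Multiset.map_coe, ← Multiset.coe_eq_coe.2 hv, ← he,
      expand_map]
    congr 1
    apply List.ext_getElem
    · simp [Ptn.m, hlen]
    · intro i h₁ h₂
      simp [hL.idxOf_getElem]

/-- All balanced words with multiplicities `P` are related. -/
def FullOn (r : Setoid Word) (P : Multiset ℕ) : Prop :=
  ∀ ⦃u v : Word⦄, Bal u v → multiplicities u.letters = P → r u v

theorem IsFullyInvariant.fullOn_of_transversal {r : Setoid Word} (hr : IsFullyInvariant r)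
    {l : Ptn} (h : ∀ u ∈ l.transversal, ∀ v ∈ l.transversal, r u v) :
    FullOn r (l.parts : Multiset ℕ) := by
  intro u v huv hu
  obtain ⟨f, g, hgf, hf⟩ := l.exists_rename_mem_transversal hu
  have := hr.map g (h _ (hf u (Bal.refl u)) _ (hf v huv))
  rwa [map_map_eq_self hgf, map_map_eq_self fun i hi => hgf i (huv.mem_iff.2 hi)] at this

/-! ### Adding a linear letter -/

/-- Match each element satisfying `p` with its right neighbour, which exists and fails `p`. A head
failing `p` stays unmatched, whence the strict inequality. -/
theorem List.countP_le_of_no_adjacent {α : Type*} (p : α → Bool) (l : List α)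
    (hadj : ∀ s x y t, l = s ++ x :: y :: t → p x → ¬ p y)
    (hlast : ∀ t x, l = t ++ [x] → ¬ p x) :
    l.countP p ≤ l.countP (fun x => ¬ p x) ∧
      ∀ x t, l = x :: t → ¬ p x → l.countP p < l.countP (fun x => ¬ p x) := by
  induction l with
  | nil => simp
  | cons a l ih =>
    have hlast' : ∀ t x, l = t ++ [x] → ¬ p x := fun t x h => hlast (a :: t) x (by rw [h]; rfl)
    obtain ⟨h₁, h₂⟩ := ih (fun s x y t h => hadj (a :: s) x y t (by rw [h]; rfl)) hlast'
    by_cases ha : p a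
    · refine ⟨?_, fun x t h hx => ?_⟩
      · cases l with
        | nil => exact absurd ha (hlast [] a rfl)
        | cons b l =>
          have := h₂ b l rfl (hadj [] a b l rfl ha)
          have e : (a :: b :: l).countP (fun x => ¬ p x) = (b :: l).countP (fun x => ¬ p x) :=
            List.countP_cons_of_neg (by simpa using ha)
          rw [e, List.countP_cons_of_pos ha]
          exact this
      · rw [(List.cons.inj h).1] at ha
        exact absurd ha hx
    · have e : (a :: l).countP (fun x => ¬ p x) = l.countP (fun x => ¬ p x) + 1 :=
        List.countP_cons_of_pos (by simpa using ha)
      rw [e, List.countP_cons_of_neg ha]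
      exact ⟨by omega, fun _ _ _ _ => by omega⟩

theorem Word.exists_bal_letters {w : Word} {l : List ℕ} (h : w.letters.Perm l) :
    ∃ u, u.letters = l ∧ Bal w u := by
  have hne : l ≠ [] := by
    rintro rfl
    exact w.letters_ne_nil (List.perm_nil.1 h)
  obtain ⟨u, rfl⟩ := exists_letters_eq hne
  exact ⟨u, rfl, h⟩

section AddLinear

variable {r : Setoid Word} {P : Multiset ℕ} {w : Word}

/-- A letter that occurs exactly once. -/
abbrev Word.IsLinear (w : Word) (x : ℕ) : Prop := (w.letters : Multiset ℕ).count x = 1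

theorem Word.IsLinear.mem {x : ℕ} (h : w.IsLinear x) : x ∈ w.letters :=
  Multiset.mem_coe.1 (Multiset.one_le_count_iff_mem.1 (le_of_eq h.symm))

theorem Word.IsLinear.notMem_of_perm {x : ℕ} (h : w.IsLinear x) {l : List ℕ}
    (hl : w.letters.Perm (x :: l)) : x ∉ l := by
  rw [IsLinear, Multiset.coe_eq_coe.2 hl, Multiset.coe_count, List.count_cons_self] at h
  exact List.count_eq_zero.1 (Nat.succ.inj h)

theorem Word.IsLinear.multiplicities_of_perm {x : ℕ} (h : w.IsLinear x) {l : List ℕ}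
    (hl : w.letters.Perm (x :: l)) (hw : multiplicities w.letters = 1 ::ₘ P) :
    multiplicities l = P := by
  have hx := h.notMem_of_perm hl
  rw [Multiset.coe_eq_coe.2 hl, ← Multiset.cons_coe,
    multiplicities_cons (M := (l : Multiset ℕ)) (by simpa using hx)] at hw
  exact (Multiset.cons_inj_right 1).1 hw

/-- Removing the common linear letter leaves balanced words with multiplicities `P`; `P ≠ 0` keeps
them nonempty. -/
theorem FullOn.rel_of_common_last (h : FullOn r P) (hr : IsFullyInvariant r) {x : ℕ}
    (hx : w.IsLinear x) (hw : multiplicities w.letters = 1 ::ₘ P) (hP : P ≠ 0) {u v : Word}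
    (hu : Bal w u) (hv : Bal w v) {s t : List ℕ} (hus : u.letters = s ++ [x])
    (hvt : v.letters = t ++ [x]) : r u v := by
  have hs : w.letters.Perm (x :: s) := by
    refine List.Perm.trans hu ?_
    rw [hus]
    exact List.perm_append_singleton x s
  have ht : w.letters.Perm (x :: t) := by
    refine List.Perm.trans hv ?_
    rw [hvt]
    exact List.perm_append_singleton x t
  have hms := hx.multiplicities_of_perm hs hw
  have hst : s.Perm t := List.Perm.cons_inv (hs.symm.trans ht)
  have hne : s ≠ [] := by
    rintro rfl
    exact hP hms.symm
  obtain ⟨s', hs'⟩ := exists_letters_eq hne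
  obtain ⟨t', rfl, hb⟩ := exists_bal_letters (hs' ▸ hst)
  subst hs'
  have := hr.mul_right (FreeSemigroup.of x) (h hb hms)
  have e₁ : u = s' * FreeSemigroup.of x := letters_injective (by rw [hus]; rfl)
  have e₂ : v = t' * FreeSemigroup.of x := letters_injective (by rw [hvt]; rfl)
  rwa [e₁, e₂]

theorem FullOn.rel_of_common_head (h : FullOn r P) (hr : IsFullyInvariant r) {x : ℕ}
    (hx : w.IsLinear x) (hw : multiplicities w.letters = 1 ::ₘ P) (hP : P ≠ 0) {u v : Word}
    (hu : Bal w u) (hv : Bal w v) {s t : List ℕ} (hus : u.letters = x :: s)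
    (hvt : v.letters = x :: t) : r u v := by
  have hs : w.letters.Perm (x :: s) := hus ▸ hu
  have ht : w.letters.Perm (x :: t) := hvt ▸ hv
  have hms := hx.multiplicities_of_perm hs hw
  have hst : s.Perm t := List.Perm.cons_inv (hs.symm.trans ht)
  have hne : s ≠ [] := by
    rintro rfl
    exact hP hms.symm
  obtain ⟨s', hs'⟩ := exists_letters_eq hne
  obtain ⟨t', rfl, hb⟩ := exists_bal_letters (hs' ▸ hst)
  subst hs'
  have := hr.mul_left (FreeSemigroup.of x) (h hb hms)
  have e₁ : u = FreeSemigroup.of x * s' := letters_injective (by rw [hus]; rfl)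
  have e₂ : v = FreeSemigroup.of x * t' := letters_injective (by rw [hvt]; rfl)
  rwa [e₁, e₂]

theorem Word.exists_bal_head_last {x y : ℕ} (hx : x ∈ w.letters) (hy : y ∈ w.letters)
    (hxy : y ≠ x) : ∃ u, Bal w u ∧ ∃ t, u.letters = y :: (t ++ [x]) := by
  have hp : w.letters.Perm (y :: (((w.letters.erase y).erase x) ++ [x])) := by
    refine (List.perm_cons_erase hy).trans (List.Perm.cons y ?_)
    refine (List.perm_cons_erase ?_).trans (List.perm_append_singleton _ _).symm
    exact (List.mem_erase_of_ne hxy.symm).2 hx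
  obtain ⟨u, hu, hb⟩ := exists_bal_letters hp
  exact ⟨u, hb, _, hu⟩

theorem Word.exists_isLinear_ne (h : 3 ≤ (multiplicities w.letters).count 1) (x y : ℕ) :
    ∃ z, w.IsLinear z ∧ z ≠ x ∧ z ≠ y := by
  rw [← countP_count_eq_one, Multiset.countP_eq_card_filter, filter_count_eq_one] at h
  have hnd : (((w.letters : Multiset ℕ).dedup.filter
      fun i => (w.letters : Multiset ℕ).count i = 1)).Nodup :=
    (Multiset.nodup_dedup _).filter _
  let F : Finset ℕ := ⟨_, hnd⟩
  have hF : ({x, y} : Finset ℕ).card < F.card := lt_of_le_of_lt Finset.card_le_two h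
  obtain ⟨z, hz, hz'⟩ := Finset.exists_mem_notMem_of_card_lt_card hF
  have hz₁ : z ∈ (w.letters : Multiset ℕ).dedup.filter
      fun i => (w.letters : Multiset ℕ).count i = 1 := hz
  refine ⟨z, (Multiset.mem_filter.1 hz₁).2, ?_⟩
  simpa using hz'

theorem List.flatMap_eq_self_of_forall {α : Type*} {f : α → List α} {l : List α}
    (h : ∀ i ∈ l, f i = [i]) : l.flatMap f = l := by
  induction l with
  | nil => rfl
  | cons a l ih =>
    rw [List.flatMap_cons, h a List.mem_cons_self,
      ih fun i hi => h i (List.mem_cons_of_mem _ hi)]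
    rfl

/-- Delete `y`, move `x` to the end by fullness on `P`, and substitute `xy` for `x` to restore `y`.
-/
theorem FullOn.exists_rel_last_of_adjacent (h : FullOn r P) (hr : IsFullyInvariant r) {x y : ℕ}
    (hx : w.IsLinear x) (hy : w.IsLinear y) (hw : multiplicities w.letters = 1 ::ₘ P) {u : Word}
    (hu : Bal w u) {s t : List ℕ} (hus : u.letters = s ++ x :: y :: t) :
    ∃ v, Bal w v ∧ r u v ∧ ∃ t, v.letters = t ++ [y] := by
  have hpx : w.letters.Perm (x :: (s ++ y :: t)) := by
    refine List.Perm.trans hu ?_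
    rw [hus]
    exact List.perm_middle
  have hpy : w.letters.Perm (y :: (s ++ x :: t)) := by
    refine List.Perm.trans hu ?_
    rw [hus]
    have := List.perm_middle (a := y) (l₁ := s ++ [x]) (l₂ := t)
    simpa using this
  have hxn := hx.notMem_of_perm hpx
  have hm := hy.multiplicities_of_perm hpy hw
  obtain ⟨u', hu'⟩ := exists_letters_eq (l := s ++ x :: t) (by simp)
  obtain ⟨v', hv', hb⟩ := exists_bal_letters (w := u') (l := (s ++ t) ++ [x]) (by
    rw [hu']
    exact List.perm_middle.trans (List.perm_append_singleton _ _).symm)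
  have hr' : r u' v' := h hb (by rw [hu', hm])
  let φ : Word →ₙ* Word := FreeSemigroup.lift fun i =>
    if i = x then FreeSemigroup.of x * FreeSemigroup.of y else FreeSemigroup.of i
  have hφx : letters (φ (FreeSemigroup.of x)) = [x, y] := by
    simp [φ, letters_mul, letters_of]
  have hφ : ∀ i, i ≠ x → letters (φ (FreeSemigroup.of i)) = [i] := by
    intro i hi
    simp [φ, hi, letters_of]
  have hsx : ∀ i ∈ s, i ≠ x := by
    rintro i hi rfl
    exact hxn (by simp [hi])
  have htx : ∀ i ∈ t, i ≠ x := by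
    rintro i hi rfl
    exact hxn (by simp [hi])
  have hs := List.flatMap_eq_self_of_forall fun i hi => hφ i (hsx i hi)
  have ht := List.flatMap_eq_self_of_forall fun i hi => hφ i (htx i hi)
  have e : φ u' = u := by
    apply letters_injective
    rw [letters_hom, hu', hus, List.flatMap_append, List.flatMap_cons, hs, ht, hφx]
    rfl
  refine ⟨φ v', hu.trans (e ▸ hb.hom φ), e ▸ hr.subst φ hr', s ++ t ++ [x], ?_⟩
  rw [letters_hom, hv', List.flatMap_append, List.flatMap_append, hs, ht, List.flatMap_cons, hφx]
  simp

/-- Words with a linear letter at either end are linked by cancelling that letter. Two adjacent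
linear letters can be moved to the end as a block. A word with neither feature would need more
nonlinear occurrences than `hsum` permits. -/
theorem FullOn.cons_one (h : FullOn r P) (hr : IsFullyInvariant r) (h2 : 2 ≤ P.count 1)
    (hsum : (P.filter fun p => 1 < p).sum ≤ P.count 1 + 1) : FullOn r (1 ::ₘ P) := by
  intro w w' hww' hw
  have hP : P ≠ 0 := by
    rintro rfl
    simp at h2
  have h3 : 3 ≤ (multiplicities w.letters).count 1 := by
    rw [hw, Multiset.count_cons_self]
    omega
  obtain ⟨x₀, hx₀, -⟩ := exists_isLinear_ne h3 0 0
  obtain ⟨y₀, hy₀, hy₀x₀, -⟩ := exists_isLinear_ne h3 x₀ x₀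
  obtain ⟨z₀, hz₀, hz₀x₀, hz₀y₀⟩ := exists_isLinear_ne h3 x₀ y₀
  obtain ⟨c, hc, tc, hct⟩ := exists_bal_head_last hx₀.mem hy₀.mem hy₀x₀
  have hct' : c.letters = (y₀ :: tc) ++ [x₀] := hct
  have cross : ∀ {x y u v s t}, w.IsLinear x → w.IsLinear y → y ≠ x → Bal w u → Bal w v →
      u.letters = s ++ [x] → v.letters = y :: t → r u v := by
    intro x y u v s t hx hy hne hu hv hus hvt
    obtain ⟨d, hd, td, hdt⟩ := exists_bal_head_last hx.mem hy.mem hne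
    exact r.trans' (h.rel_of_common_last hr hx hw hP hu hd hus (t := y :: td) hdt)
      (h.rel_of_common_head hr hy hw hP hd hv hdt hvt)
  have hlast : ∀ {x u s}, w.IsLinear x → Bal w u → u.letters = s ++ [x] → r u c := by
    intro x u s hx hu hus
    -- `cross` needs distinct letters, so if `u` ends in the first letter of `c`, a detour uses a
    -- third linear letter.
    by_cases hxy : y₀ = x
    · subst hxy
      obtain ⟨d, hd, td, hdt⟩ := exists_bal_head_last hx₀.mem hz₀.mem hz₀x₀
      exact r.trans' (cross hx hz₀ hz₀y₀ hu hd hus hdt)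
        (h.rel_of_common_last hr hx₀ hw hP hd hc (s := z₀ :: td) hdt hct')
    · exact cross hx hy₀ hxy hu hc hus hct
  have hhead : ∀ {x u s}, w.IsLinear x → Bal w u → u.letters = x :: s → r u c := by
    intro x u s hx hu hus
    obtain ⟨y, hy, hyx, -⟩ := exists_isLinear_ne h3 x x
    obtain ⟨d, hd, td, hdt⟩ := exists_bal_head_last hy.mem hx.mem hyx.symm
    exact r.trans' (h.rel_of_common_head hr hx hw hP hu hd hus hdt)
      (hlast hy hd (s := x :: td) hdt)
  have hall : ∀ u, Bal w u → r u c := by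
    intro u hu
    have hcoe : (u.letters : Multiset ℕ) = w.letters := (Multiset.coe_eq_coe.2 hu).symm
    by_cases h₁ : ∃ x t, u.letters = x :: t ∧ w.IsLinear x
    · obtain ⟨x, t, hxt, hx⟩ := h₁
      exact hhead hx hu hxt
    by_cases h₂ : ∃ x t, u.letters = t ++ [x] ∧ w.IsLinear x
    · obtain ⟨x, t, hxt, hx⟩ := h₂
      exact hlast hx hu hxt
    by_cases h₃ : ∃ s x y t, u.letters = s ++ x :: y :: t ∧ w.IsLinear x ∧ w.IsLinear y
    · obtain ⟨s, x, y, t, hxt, hx, hy⟩ := h₃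
      obtain ⟨v, hv, huv, t', hvt⟩ := h.exists_rel_last_of_adjacent hr hx hy hw hu hxt
      exact r.trans' huv (hlast hy hv hvt)
    exfalso
    push Not at h₁ h₂ h₃
    -- Linear letters are now isolated and absent from both ends, so they are strictly fewer than
    -- the nonlinear occurrences.
    have hcount := (List.countP_le_of_no_adjacent
      (fun i => decide ((w.letters : Multiset ℕ).count i = 1)) u.letters
      (fun s x y t e hx hy => h₃ s x y t e (of_decide_eq_true hx) (of_decide_eq_true hy))
      (fun t x e hx => h₂ x t e (of_decide_eq_true hx))).2 u.head u.tail rfl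
      (fun hx => h₁ u.head u.tail rfl (of_decide_eq_true hx))
    have e₁ := countP_count_eq_one (w.letters : Multiset ℕ)
    have e₂ := countP_count_ne_one (w.letters : Multiset ℕ)
    rw [hw, Multiset.count_cons_self] at e₁
    rw [hw, Multiset.filter_cons_of_neg (p := fun p => 1 < p) _ (by omega)] at e₂
    have e₃ : u.letters.countP (fun i => decide ((w.letters : Multiset ℕ).count i = 1)) =
        (w.letters : Multiset ℕ).countP (fun i => (w.letters : Multiset ℕ).count i = 1) := by
      rw [Multiset.coe_countP]
      exact (List.Perm.countP_eq _ hu).symm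
    have e₄ : u.letters.countP
        (fun i => decide (¬ decide ((w.letters : Multiset ℕ).count i = 1) = true)) =
        (w.letters : Multiset ℕ).countP (fun i => ¬ (w.letters : Multiset ℕ).count i = 1) := by
      rw [Multiset.coe_countP, List.Perm.countP_eq _ hu]
      simp
    rw [e₃, e₄, e₁, e₂] at hcount
    omega
  exact r.trans' (hall w (Bal.refl w)) (r.symm' (hall w' hww'))

end AddLinear

/-! ### The varieties `𝒮_λ` -/

namespace Ptn

theorem count_one_addOnes (l : Ptn) (k : ℕ) :
    ((l.addOnes k).parts : Multiset ℕ).count 1 = l.q + k := by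
  simp [addOnes, q]

theorem sum_filter_addOnes (l : Ptn) (k : ℕ) :
    (((l.addOnes k).parts : Multiset ℕ).filter fun p => 1 < p).sum = l.r := by
  simp [addOnes, r, List.filter_append]

theorem parts_addOnes_succ (l : Ptn) (k : ℕ) :
    ((l.addOnes (k + 1)).parts : Multiset ℕ) = 1 ::ₘ ((l.addOnes k).parts : Multiset ℕ) := by
  rw [Multiset.cons_coe, Multiset.coe_eq_coe]
  simp only [addOnes, List.replicate_succ]
  exact List.perm_middle

theorem r_le_q_add_s (l : Ptn) : l.r ≤ l.q + l.s + 1 := by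
  have : l.delta ≤ 1 := by
    unfold delta
    split_ifs <;> omega
  unfold s
  omega

/-- The exceptional `delta` serves this bound: for `(2,1)` one has `q = 1` and `r = 2`, and only
`delta = 0` gives `s = 1`. -/
theorem two_le_q_add_s (l : Ptn) : 2 ≤ l.q + l.s := by
  by_contra hcon
  have hr := l.r_le_q_add_s
  obtain ⟨a, b, t, hp⟩ : ∃ a b t, l.parts = a :: b :: t := by
    have := l.two_le
    match h : l.parts with
    | [] => simp [h] at this
    | [a] => simp [h] at this
    | a :: b :: t => exact ⟨a, b, t, rfl⟩
  have hsorted := l.sorted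
  have hpos := l.pos
  rw [hp] at hsorted hpos
  simp only [List.pairwise_cons, List.mem_cons] at hsorted hpos
  have hab : a ≥ b := hsorted.1 b (Or.inl rfl)
  have hb : 0 < b := hpos b (Or.inr (Or.inl rfl))
  by_cases hb2 : 1 < b
  · have ha2 : 1 < a := by omega
    have : a + b ≤ l.r := by
      simp [r, hp, ha2, hb2, ← add_assoc]
    omega
  obtain rfl : b = 1 := by omega
  have ht : t = [] := by
    cases t with
    | nil => rfl
    | cons c t =>
      exfalso
      have h₁ := hsorted.2.1 c (by simp)
      have h₂ := hpos c (by simp)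
      obtain rfl : c = 1 := by omega
      have : 2 ≤ l.q := by
        simp only [q, hp, List.count_cons, beq_self_eq_true, if_true]
        omega
      omega
  subst ht
  by_cases ha : a = 1
  · subst ha
    have : l.q = 2 := by simp [q, hp]
    omega
  · have ha2 : 1 < a := by omega
    have hq : l.q = 1 := by simp [q, hp, ha]
    have hr : l.r = a := by simp [r, hp, ha2]
    by_cases ha' : a = 2
    · have hd : l.delta = 0 := by simp [delta, hp, ha']
      have : l.s = 1 := by
        unfold s
        omega
      omega
    · have : l.delta ≤ 1 := by
        unfold delta
        split_ifs <;> omega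
      have : 1 ≤ l.s := by
        unfold s
        omega
      omega

/-- Some word with multiplicities `λ` can be mapped, by a substitution of letters for letters,
to a word whose letters are among those of `w`, counted with multiplicity. -/
def Below (l : Ptn) (w : Word) : Prop :=
  ∃ L : List ℕ, l.parts.length = L.length ∧ expand l.parts L ≤ (w.letters : Multiset ℕ)

theorem Below.of_bal {l : Ptn} {u v : Word} (h : l.Below u) (hb : Bal u v) : l.Below v := by
  obtain ⟨L, hL, h⟩ := h
  exact ⟨L, hL, h.trans (Multiset.coe_eq_coe.2 hb).le⟩

theorem Below.mul_left {l : Ptn} {u : Word} (h : l.Below u) (w : Word) : l.Below (w * u) := by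
  obtain ⟨L, hL, h⟩ := h
  refine ⟨L, hL, h.trans ?_⟩
  rw [letters_mul, ← Multiset.coe_add]
  exact Multiset.le_add_left _ _

theorem Below.mul_right {l : Ptn} {u : Word} (h : l.Below u) (w : Word) : l.Below (u * w) := by
  obtain ⟨L, hL, h⟩ := h
  refine ⟨L, hL, h.trans ?_⟩
  rw [letters_mul, ← Multiset.coe_add]
  exact Multiset.le_add_right _ _

/-- Keep only the first letter of each substituted word. Distinct letters may then coincide, which
is why `L` may have repetitions. -/
theorem Below.hom {l : Ptn} {u : Word} (h : l.Below u) (φ : Word →ₙ* Word) : l.Below (φ u) := by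
  obtain ⟨L, hL, h⟩ := h
  let f : ℕ → ℕ := fun i => (φ (FreeSemigroup.of i)).head
  refine ⟨L.map f, by simpa using hL, ?_⟩
  rw [← expand_map]
  refine (Multiset.map_le_map h).trans ?_
  rw [Multiset.map_coe, letters_hom]
  apply List.Sublist.subperm
  generalize u.letters = t
  induction t with
  | nil => simp
  | cons a t ih =>
    rw [List.map_cons, List.flatMap_cons]
    have : List.Sublist [f a] (letters (φ (FreeSemigroup.of a))) := by
      simp [letters, f]
    exact List.Sublist.append this ih

/-- The congruence that is universal exactly on the words above `λ`. -/
def belowSetoid (l : Ptn) : Setoid Word where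
  r u v := u = v ∨ Bal u v ∧ l.Below u
  iseqv := by
    refine ⟨fun _ => Or.inl rfl, ?_, ?_⟩
    · rintro u v (h | ⟨h, h'⟩)
      · exact Or.inl h.symm
      · exact Or.inr ⟨h.symm, h'.of_bal h⟩
    · rintro u v w (rfl | ⟨h, h'⟩) (rfl | ⟨h₁, h₁'⟩)
      · exact Or.inl rfl
      · exact Or.inr ⟨h₁, h₁'⟩
      · exact Or.inr ⟨h, h'⟩
      · exact Or.inr ⟨h.trans h₁, h'⟩

theorem belowSetoid_fullyInvariant (l : Ptn) : IsFullyInvariant l.belowSetoid where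
  mul_left := by
    rintro w u v (rfl | ⟨h, h'⟩)
    · exact Or.inl rfl
    · exact Or.inr ⟨h.mul_left w, h'.mul_left w⟩
  mul_right := by
    rintro w u v (rfl | ⟨h, h'⟩)
    · exact Or.inl rfl
    · exact Or.inr ⟨h.mul_right w, h'.mul_right w⟩
  subst := by
    rintro φ u v (rfl | ⟨h, h'⟩)
    · exact Or.inl rfl
    · exact Or.inr ⟨h.hom φ, h'.hom φ⟩

theorem belowSetoid_isLocallyTrivialOrFull (l : Ptn) : IsLocallyTrivialOrFull l.belowSetoid := by
  rintro a b (h | ⟨-, h⟩) hne u hu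
  · exact absurd h hne
  · exact Or.inr ⟨hu, h⟩

theorem below_of_mem_transversal_addOnes {l : Ptn} {k : ℕ} {u : Word}
    (hu : u ∈ (l.addOnes k).transversal) : l.Below u := by
  rw [mem_transversal_iff] at hu
  refine ⟨List.range l.m, by simp [m], ?_⟩
  have hm : (l.addOnes k).m = l.m + k := by simp [addOnes, m]
  rw [hu, hm, List.range_add]
  change _ ≤ expand (l.parts ++ List.replicate k 1) _
  rw [expand_append (by simp [m])]
  exact Multiset.le_add_right _ _

/-- A word above the partition is obtained by identifying letters in a word with multiplicities
given by some `addOnes`, where the related pair already exists. -/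
theorem belowSetoid_le {l : Ptn} {r : Setoid Word} (hr : IsFullyInvariant r)
    (h : ∀ k, FullOn r ((l.addOnes k).parts : Multiset ℕ)) : l.belowSetoid ≤ r := by
  rintro u v (rfl | ⟨hb, L, hL, hle⟩)
  · exact r.refl' _
  obtain ⟨N, hN⟩ := Multiset.le_iff_exists_add.1 hle
  -- Each occurrence left over in `N` gets its own linear letter before identification.
  let K := L ++ N.toList
  let ps := (l.addOnes N.toList.length).parts
  have hlen : ps.length = K.length := by
    simp [ps, K, addOnes, hL]
  have hK : (u.letters : Multiset ℕ) = expand ps K := by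
    rw [hN]
    change _ = expand (l.parts ++ _) (L ++ _)
    rw [expand_append hL, expand_replicate_one, Multiset.coe_toList]
  let B := expand ps (List.range K.length)
  let f : ℕ → ℕ := fun i => K.getD i 0
  have hBf : B.map f = expand ps K := by
    rw [expand_map]
    congr 1
    apply List.ext_getElem
    · simp
    · intro i h₁ h₂
      simp [f, h₂]
  have hlift : ∀ w : Word, Bal u w → ∃ w' : Word, (w'.letters : Multiset ℕ) = B ∧
      FreeSemigroup.map f w' = w := by
    intro w hw
    have hp : w.letters.Perm (B.toList.map f) := by
      rw [← Multiset.coe_eq_coe, ← Multiset.map_coe, Multiset.coe_toList, hBf, ← hK]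
      exact (Multiset.coe_eq_coe.2 hw).symm
    have := congrFun (congrFun (List.eq_map_comp_perm f) w.letters) B.toList
    rw [eq_iff_iff] at this
    obtain ⟨t, ht, htB⟩ := this.2 hp
    have hne : t ≠ [] := by
      rintro rfl
      exact w.letters_ne_nil ht
    obtain ⟨w', rfl⟩ := exists_letters_eq hne
    refine ⟨w', ?_, letters_injective (by rw [letters_map, ht])⟩
    rw [Multiset.coe_eq_coe.2 htB, Multiset.coe_toList]
  obtain ⟨u', hu', rfl⟩ := hlift u (Bal.refl u)
  obtain ⟨v', hv', rfl⟩ := hlift v hb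
  apply hr.map
  refine h N.toList.length (Multiset.coe_eq_coe.1 (hu'.trans hv'.symm)) ?_
  rw [hu', multiplicities_expand (by rwa [List.length_range]) List.nodup_range (Ptn.pos _)]

/-- Fullness for at most `s` added ones is given; beyond that, `q + s` is large enough for
`FullOn.cons_one` to continue indefinitely. -/
theorem eqs_varS (l : Ptn) : l.varS.{u}.eqs = l.belowSetoid := by
  apply le_antisymm
  · have : SemigroupVariety.ofSetoid l.belowSetoid ≤ l.varS.{u} := by
      refine Finset.le_inf fun i _ => ?_
      rw [← SemigroupVariety.eqs_le_iff,
        SemigroupVariety.eqs_ofSetoid l.belowSetoid_fullyInvariant]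
      refine SemigroupVariety.eqs_var_le l.belowSetoid_fullyInvariant fun p hp => ?_
      exact Or.inr ⟨bal_of_mem_transversal hp.1 hp.2, below_of_mem_transversal_addOnes hp.1⟩
    have h := SemigroupVariety.eqs_anti this
    rwa [SemigroupVariety.eqs_ofSetoid l.belowSetoid_fullyInvariant] at h
  · have hfi := l.varS.{u}.eqs_fullyInvariant
    refine belowSetoid_le hfi fun k => ?_
    have hsmall : ∀ i ≤ l.s, FullOn l.varS.{u}.eqs ((l.addOnes i).parts : Multiset ℕ) := by
      intro i hi
      refine hfi.fullOn_of_transversal fun u hu v hv => ?_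
      have hle : l.varS.{u} ≤ (l.addOnes i).varW :=
        Finset.inf_le (Finset.mem_range.2 (Nat.lt_succ_of_le hi))
      exact SemigroupVariety.eqs_anti hle
        (SemigroupVariety.eqs_var_of_mem (p := (u, v)) ⟨hu, hv⟩)
    induction k with
    | zero => exact hsmall 0 (Nat.zero_le _)
    | succ k ih =>
      by_cases hk : k + 1 ≤ l.s
      · exact hsmall _ hk
      · have h₁ := l.two_le_q_add_s
        have h₂ := l.r_le_q_add_s
        rw [parts_addOnes_succ]
        refine ih.cons_one hfi ?_ ?_
        · rw [count_one_addOnes]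
          omega
        · rw [count_one_addOnes, sum_filter_addOnes]
          omega

/-! ### Finite bases -/

/-- `λ` embeds into `μ` componentwise. -/
def Embeds (l k : Ptn) : Prop := List.SublistForall₂ (fun a b => a ≤ b) l.parts k.parts

/-- Otherwise a sequence could be chosen in which no term embeds into a later one, contrary to
Higman's lemma. -/
theorem exists_finset_embeds (U : Set Ptn) :
    ∃ F : Finset Ptn, (∀ l ∈ F, l ∈ U) ∧ ∀ k ∈ U, ∃ l ∈ F, Embeds l k := by
  by_contra hcon
  push Not at hcon
  obtain ⟨f, -, hf⟩ := exists_seq_of_forall_finset_exists (fun l => l ∈ U)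
    (fun l k => ¬ Embeds l k) hcon
  have hN : (Set.univ : Set ℕ).PartiallyWellOrderedOn (fun a b => a ≤ b) :=
    Set.IsPWO.of_linearOrder _
  obtain ⟨m, n, hmn, h⟩ := hN.partiallyWellOrderedOn_sublistForall₂.exists_lt
    (f := fun n => (f n).parts) (fun _ _ _ => trivial)
  exact hf m n hmn h

/-- Drop the letters of skipped parts and lower the multiplicities of the others. -/
theorem exists_expand_le_of_sublistForall₂ {ps qs : List ℕ}
    (h : List.SublistForall₂ (fun a b => a ≤ b) ps qs) :
    ∀ L : List ℕ, qs.length = L.length →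
      ∃ L' : List ℕ, ps.length = L'.length ∧ expand ps L' ≤ expand qs L := by
  induction h with
  | nil => exact fun L _ => ⟨[], rfl, by simp⟩
  | @cons p q ps qs hpq _ ih =>
    intro L hL
    cases L with
    | nil => simp at hL
    | cons x L =>
      obtain ⟨L', h₁, h₂⟩ := ih L (Nat.succ.inj hL)
      refine ⟨x :: L', by simp [h₁], ?_⟩
      rw [expand_cons, expand_cons]
      exact add_le_add ((Multiset.replicate_le_replicate x).2 hpq) h₂
  | @cons_right q ps qs _ ih =>
    intro L hL
    cases L with
    | nil => simp at hL
    | cons x L =>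
      obtain ⟨L', h₁, h₂⟩ := ih L (Nat.succ.inj hL)
      refine ⟨L', h₁, h₂.trans ?_⟩
      rw [expand_cons]
      exact Multiset.le_add_left _ _

theorem Embeds.below {l k : Ptn} (h : Embeds l k) {w : Word}
    (hw : multiplicities w.letters = k.parts) : l.Below w := by
  obtain ⟨L, -, hL, he, -⟩ := exists_expand_eq hw
  obtain ⟨L', h₁, h₂⟩ := exists_expand_le_of_sublistForall₂ h L hL
  exact ⟨L', h₁, he ▸ h₂⟩

theorem exists_multiplicities_eq {a b : Word} (hb : Bal a b) (hne : a ≠ b) :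
    ∃ l : Ptn, multiplicities a.letters = l.parts := by
  refine ⟨⟨(multiplicities a.letters).sort (fun a b => a ≥ b), Multiset.pairwise_sort _ _,
    fun p hp => ?_, ?_⟩, (Multiset.sort_eq _ _).symm⟩
  · rw [Multiset.mem_sort] at hp
    exact pos_of_mem_multiplicities hp
  · rw [Multiset.length_sort, multiplicities, Multiset.card_map]
    obtain ⟨y, hy, hyx⟩ := exists_ne_of_bal_of_ne hb hne a.head
    have : 1 < a.content.card :=
      Finset.one_lt_card.2 ⟨y, mem_content.2 hy, a.head, mem_content.2 List.mem_cons_self, hyx⟩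
    exact this

theorem exists_bal_ne (l : Ptn) :
    ∃ a b : Word, Bal a b ∧ a ≠ b ∧ multiplicities a.letters = l.parts := by
  have hlen : l.parts.length = (List.range l.m).length := by simp [m]
  have hm : 2 ≤ l.m := l.two_le
  have hmem : ∀ i < 2, i ∈ expand l.parts (List.range l.m) := fun i hi =>
    (mem_expand hlen l.pos).2 (List.mem_range.2 (by omega))
  obtain ⟨M, hM⟩ := Multiset.exists_cons_of_mem (hmem 0 (by omega))
  obtain ⟨N, rfl⟩ := Multiset.exists_cons_of_mem (a := 1) (s := M) (by
    have := hmem 1 (by omega)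
    rw [hM] at this
    simpa using this)
  obtain ⟨a, ha⟩ := exists_letters_eq (l := 0 :: 1 :: N.toList) (by simp)
  obtain ⟨b, hb⟩ := exists_letters_eq (l := 1 :: 0 :: N.toList) (by simp)
  refine ⟨a, b, ?_, ?_, ?_⟩
  · rw [Bal, ha, hb]
    exact List.Perm.swap _ _ _
  · rintro rfl
    simp [ha] at hb
  · rw [ha, ← Multiset.cons_coe, ← Multiset.cons_coe, Multiset.coe_toList, ← hM,
      multiplicities_expand hlen List.nodup_range l.pos]

end Ptn

/-! ### Classification of locally trivial or full congruences -/

theorem IsLocallyTrivialOrFull.fullOn {r : Setoid Word} (h : IsLocallyTrivialOrFull r)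
    (hr : IsFullyInvariant r) (hrb : IsBalanced r) {a b : Word} (hab : r a b) (hne : a ≠ b)
    {l : Ptn} (hl : multiplicities a.letters = l.parts) : FullOn r (l.parts : Multiset ℕ) := by
  obtain ⟨f, g, hgf, hf⟩ := l.exists_rename_mem_transversal hl
  have hab' := hr.map f hab
  have hne' : FreeSemigroup.map f a ≠ FreeSemigroup.map f b := by
    intro he
    apply hne
    rw [← map_map_eq_self hgf, he, map_map_eq_self fun i hi => hgf i ((hrb hab).mem_iff.2 hi)]
  refine hr.fullOn_of_transversal fun u hu v hv => ?_
  have ha := hf a (Bal.refl a)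
  exact r.trans' (r.symm' (h hab' hne' u (Ptn.bal_of_mem_transversal ha hu)))
    (h hab' hne' v (Ptn.bal_of_mem_transversal ha hv))

/-- Multiplying a nontrivial pair by a fresh letter keeps it nontrivial and adds one linear letter;
one such pair makes the new class full. -/
theorem IsLocallyTrivialOrFull.fullOn_addOnes {r : Setoid Word} (h : IsLocallyTrivialOrFull r)
    (hr : IsFullyInvariant r) (hrb : IsBalanced r) {l : Ptn}
    (hl : FullOn r (l.parts : Multiset ℕ)) (k : ℕ) :
    FullOn r ((l.addOnes k).parts : Multiset ℕ) := by
  induction k with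
  | zero => simpa [Ptn.addOnes] using hl
  | succ k ih =>
    obtain ⟨a, b, hab, hne, ha⟩ := (l.addOnes k).exists_bal_ne
    obtain ⟨x, hx⟩ := Infinite.exists_notMem_finset a.content
    have hxa : x ∉ (a.letters : Multiset ℕ) := fun h => hx (mem_content.2 h)
    refine h.fullOn hr hrb (hr.mul_right (FreeSemigroup.of x) (ih hab ha)) (fun he => hne ?_) ?_
    · apply letters_injective
      have := congrArg letters he
      rw [letters_mul, letters_mul] at this
      exact List.append_cancel_right this
    · rw [letters_mul, letters_of, Multiset.coe_eq_coe.2 (List.perm_append_singleton x a.letters),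
        ← Multiset.cons_coe, multiplicities_cons hxa, ha, Ptn.parts_addOnes_succ]

/-- The partitions on which the congruence is full have a finite basis under embedding. Each
nontrivial pair then lies above a basis member, and conversely the congruence is full above every
basis member. -/
theorem exists_eq_inf_varS {V : OC.{u}} (h : IsLocallyTrivialOrFull V.1.eqs) :
    (V : SemigroupVariety.{u}) = ⊤ ∨ ∃ (k : ℕ) (l : Fin k → Ptn), 0 < k ∧
      (V : SemigroupVariety.{u}) = Finset.univ.inf fun i => (l i).varS := by
  have hr := V.1.eqs_fullyInvariant
  have hrb : IsBalanced V.1.eqs := SemigroupVariety.COM_le_iff.1 V.2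
  by_cases hbot : V.1.eqs = ⊥
  · left
    exact SemigroupVariety.eqs_injective (hbot.trans SemigroupVariety.eqs_top.symm)
  right
  obtain ⟨F, hFU, hF⟩ := Ptn.exists_finset_embeds {l | FullOn V.1.eqs (l.parts : Multiset ℕ)}
  have hbelow : ∀ {a b}, V.1.eqs a b → a ≠ b → ∃ l ∈ F, l.Below a := by
    intro a b hab hne
    obtain ⟨k, hk⟩ := Ptn.exists_multiplicities_eq (hrb hab) hne
    obtain ⟨l, hl, hlk⟩ := hF k (h.fullOn hr hrb hab hne hk)
    exact ⟨l, hl, hlk.below hk⟩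
  refine ⟨F.card, fun i => F.equivFin.symm i, ?_, le_antisymm ?_ ?_⟩
  · rw [Finset.card_pos]
    by_contra hempty
    rw [Finset.not_nonempty_iff_eq_empty] at hempty
    apply hbot
    rw [eq_bot_iff]
    intro a b hab
    by_contra hne
    obtain ⟨l, hl, -⟩ := hbelow hab hne
    simp [hempty] at hl
  · refine Finset.le_inf fun i _ => ?_
    rw [← SemigroupVariety.eqs_le_iff, Ptn.eqs_varS]
    exact Ptn.belowSetoid_le hr (h.fullOn_addOnes hr hrb (hFU _ (F.equivFin.symm i).2))
  · rw [← SemigroupVariety.eqs_le_iff]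
    intro a b hab
    by_cases hne : a = b
    · rw [hne]
    · obtain ⟨l, hl, hla⟩ := hbelow hab hne
      have hle : (Finset.univ.inf fun i => (F.equivFin.symm i : Ptn).varS.{u}) ≤ l.varS := by
        have := Finset.inf_le (f := fun i => (F.equivFin.symm i : Ptn).varS.{u})
          (Finset.mem_univ (F.equivFin ⟨l, hl⟩))
        simpa using this
      apply SemigroupVariety.eqs_anti hle
      rw [Ptn.eqs_varS]
      exact Or.inr ⟨hrb hab, hla⟩

theorem isLocallyTrivialOrFull_of_eq_inf_varS {V : SemigroupVariety.{u}}
    (h : V = ⊤ ∨ ∃ (k : ℕ) (l : Fin k → Ptn), 0 < k ∧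
      V = Finset.univ.inf fun i => (l i).varS) : IsLocallyTrivialOrFull V.eqs := by
  have htop : IsLocallyTrivialOrFull (⊤ : SemigroupVariety.{u}).eqs := by
    intro a b hab hne
    rw [SemigroupVariety.eqs_top] at hab
    exact absurd hab hne
  rcases h with rfl | ⟨k, l, -, rfl⟩
  · exact htop
  · refine Finset.inf_induction (p := fun V : SemigroupVariety.{u} =>
      IsLocallyTrivialOrFull V.eqs) htop (fun V hV W hW => ?_) fun i _ => ?_
    · rw [SemigroupVariety.eqs_inf]
      exact hV.sup hW
    · rw [Ptn.eqs_varS]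
      exact (l i).belowSetoid_isLocallyTrivialOrFull

theorem theorem2p1 (V : OC.{u}) :
    List.TFAE [
      IsDistributiveElement V,
      IsCodistributiveElement V,
      IsStandardElement V,
      IsCostandardElement V,
      IsNeutralElement V,
      (V : SemigroupVariety.{u}) = ⊤ ∨
        ∃ (k : ℕ) (l : Fin k → Ptn), 0 < k ∧
          (V : SemigroupVariety.{u}) = Finset.univ.inf fun i => (l i).varS] := by
  have hdesc : IsSemidistributive V.1.eqs → (V : SemigroupVariety.{u}) = ⊤ ∨
      ∃ (k : ℕ) (l : Fin k → Ptn), 0 < k ∧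
        (V : SemigroupVariety.{u}) = Finset.univ.inf fun i => (l i).varS := fun h =>
    exists_eq_inf_varS (h.isLocallyTrivialOrFull V.1.eqs_fullyInvariant
      (SemigroupVariety.COM_le_iff.1 V.2))
  tfae_have 5 → 3 := fun h => h.isStandardElement
  tfae_have 5 → 4 := fun h => h.isCostandardElement
  tfae_have 3 → 1 := fun h => h.isDistributiveElement
  tfae_have 4 → 2 := fun h => h.isCodistributiveElement
  tfae_have 1 → 6 := fun h => hdesc h.isSemidistributive
  tfae_have 2 → 6 := fun h => hdesc h.isSemidistributive
  tfae_have 6 → 5 := fun h =>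
    isNeutralElement_of_isLocallyTrivialOrFull (isLocallyTrivialOrFull_of_eq_inf_varS h)
  tfae_finish
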